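/- Let $n\ge 1$. For a lattice $\Lambda\subset\mathbb C$ of rank two with Weierstrass functions $\sigma,\zeta$, and for $s\in\mathbb C\setminus\Lambda$, $\alpha\in\mathbb C$, put \[ \Phi_s(t)=\frac{\sigma(s-t)}{\sigma(s)\sigma(t)}e^{\zeta(s)t},\qquad f_{\rm Kr}(t)=\frac{e^{\alpha t}}{\Phi_s(t)} . \] For a degenerate elliptic curve these functions are replaced by $f_{\rm Kr}(t)=\dfrac{e^{\lambda t}}{q+\eta\coth \eta t}$ with $\lambda,q,\eta\in\mathbb C$ (for $\eta=0$ understood as the limit $\dfrac{te^{\lambda t}}{1+qt}$). Let $f=f_{\rm Kr}$ be any of these functions, degenerate or not (that is, a function defining a complex Krichever genus). Theorem. The function $f$ satisfies, near the origin, the Hirzebruch functional equation \[ \sum_{k=0}^n\ \prod_{i\ne k}\frac1{f(u_i-u_k)}=C \] for some constant $C$ (that is, $f$ defines an $n$-multiplicative Hirzebruch genus) if and only if one of the following holds: (i) $f(t)=f_{\rm Td}(t)=\dfrac{e^{\alpha t}-e^{\beta t}}{\alpha e^{\beta t}-\beta e^{\alpha t}}$ for some $\alpha,\beta\in\mathbb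 C$ (for $\alpha=\beta$ understood as the limit $\dfrac{t}{1-\alpha t}$); (ii) $f$ is an elliptic function of level $d$, possibly degenerate, for some $d>1$ dividing $n+1$. Here $f$ is an elliptic function of level $d$ if, for some lattice $\Lambda\subset\mathbb{C}$ of rank two and some $P\notin\Lambda$, $f(t)=t+\dots$ is meromorphic and $f^d$ is a $\Lambda$-periodic function that has zeros of order $d$ at the points of $\Lambda$, poles of order $d$ at the points of $P+\Lambda$, and no other zeros or poles. It is a degenerate elliptic function of level $d$ if $f(t)=\frac1\mu e^{(2k/d-1)\mu t}\sinh\mu t$ for some $\mu\in\mathbb C\setminus\{0\}$ and some integer $k$ with $0<k<d$. -/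

import Mathlib

open Filter Topology

noncomputable section

namespace KricheverGenus

/-- The Weierstrass sigma function of the lattice `Λ` of `L`:
`σ(z) = z ∏_{l ∈ Λ, l ≠ 0} (1 - z / l) exp (z / l + z² / (2 l²))`.
The product may run over all of `Λ`, since the factor at `l = 0` is `1` (division by zero is zero). -/
def sigma (L : PeriodPair) (z : ℂ) : ℂ :=
  z * ∏' l : L.lattice,
    ((1 - z / (l : ℂ)) * Complex.exp (z / (l : ℂ) + z ^ 2 / (2 * (l : ℂ) ^ 2)))

/-- The Weierstrass zeta function of the lattice `Λ` of `L`: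
`ζ(z) = 1 / z + ∑_{l ∈ Λ, l ≠ 0} (1 / (z - l) + 1 / l + z / l²)`.
The summand at `l = 0` is `1 / z` (division by zero is zero). -/
def zeta (L : PeriodPair) (z : ℂ) : ℂ :=
  ∑' l : L.lattice, (1 / (z - (l : ℂ)) + 1 / (l : ℂ) + z / (l : ℂ) ^ 2)

/-- The Baker--Akhiezer function `Φ_s(t) = σ(s - t) / (σ(s) σ(t)) * exp (ζ(s) t)`. -/
def bakerAkhiezer (L : PeriodPair) (s t : ℂ) : ℂ :=
  sigma L (s - t) / (sigma L s * sigma L t) * Complex.exp (zeta L s * t)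

/-- The function `exp (α t) / Φ_s(t)` of a nondegenerate Krichever genus. -/
def kricheverFun (L : PeriodPair) (α s t : ℂ) : ℂ :=
  Complex.exp (α * t) / bakerAkhiezer L s t

/-- The function `exp (lam t) / (q + η coth (η t))` of a degenerate Krichever genus, with numerator
and denominator multiplied by `sinh (η t)` so that it has the right value at `t = 0`; for `η = 0` it
is the limit `t exp (lam t) / (1 + q t)`. -/
def degenerateKricheverFun (lam q η t : ℂ) : ℂ :=
  if η = 0 then t * Complex.exp (lam * t) / (1 + q * t)
  else Complex.exp (lam * t) * Complex.sinh (η * t) /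
    (q * Complex.sinh (η * t) + η * Complex.cosh (η * t))

/-- `f` is the function of a complex Krichever genus, of a nondegenerate or a degenerate curve. -/
def IsKricheverFunction (f : ℂ → ℂ) : Prop :=
  (∃ (L : PeriodPair) (α s : ℂ), s ∉ L.lattice ∧ f = kricheverFun L α s) ∨
    ∃ lam q η : ℂ, f = degenerateKricheverFun lam q η

/-- The germ at `0` of `f` solves the Hirzebruch functional equation
`∑_{k = 0}^n ∏_{i ≠ k} 1 / f (u_i - u_k) = C` for some constant `C`: the equation holds for all
`(u_0, …, u_n)` near `0` with pairwise distinct coordinates. -/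
def SolvesHirzebruchEquation (n : ℕ) (f : ℂ → ℂ) : Prop :=
  ∃ C : ℂ, ∀ᶠ u : Fin (n + 1) → ℂ in 𝓝 0, Function.Injective u →
    ∑ k, ∏ i ∈ Finset.univ.erase k, 1 / f (u i - u k) = C

/-- The function `(exp (α t) - exp (β t)) / (α exp (β t) - β exp (α t))` of the two-parametric Todd
genus; for `α = β` it is the limit `t / (1 - α t)`. -/
def toddFun (α β t : ℂ) : ℂ :=
  if α = β then t / (1 - α * t)
  else (Complex.exp (α * t) - Complex.exp (β * t)) /
    (α * Complex.exp (β * t) - β * Complex.exp (α * t))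

/-- `g` is meromorphic, periodic with respect to the lattice `Λ` of `L`, has zeros of order `d` at
the points of `Λ`, poles of order `d` at the points of `P + Λ`, no other zeros or poles, and
`g(t) = t ^ d + …` at `0`. Values of meromorphic functions at single points are disregarded. -/
structure IsLevelPower (L : PeriodPair) (d : ℕ) (P : ℂ) (g : ℂ → ℂ) : Prop where
  meromorphic : Meromorphic g
  periodic : ∀ l ∈ L.lattice, (fun z => g (z + l)) =ᶠ[codiscrete ℂ] g
  pole_notMem : P ∉ L.lattice
  order_zero : ∀ z ∈ L.lattice, meromorphicOrderAt g z = (d : ℤ)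
  order_pole : ∀ z, z - P ∈ L.lattice → meromorphicOrderAt g z = (-(d : ℤ) : ℤ)
  order_other : ∀ z, z ∉ L.lattice → z - P ∉ L.lattice → meromorphicOrderAt g z = 0
  normalized : Tendsto (fun z => g z / z ^ d) (𝓝[≠] 0) (𝓝 1)

/-- `f` is an elliptic function of level `d`: the `d`-th root `f(t) = t + …`, for some `d > 1`, of a
function as in `IsLevelPower`. -/
def IsEllipticOfLevel (d : ℕ) (f : ℂ → ℂ) : Prop :=
  1 < d ∧ ∃ (L : PeriodPair) (P : ℂ) (g : ℂ → ℂ), IsLevelPower L d P g ∧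
    Meromorphic f ∧ (fun z => f z ^ d) =ᶠ[codiscrete ℂ] g ∧
    Tendsto (fun z => f z / z) (𝓝[≠] 0) (𝓝 1)

/-- `f` is a degenerate elliptic function of level `d` (the elliptic curve being replaced by a nodal
one and the pole tending to the node): `f(t) = exp ((2 k / d - 1) μ t) sinh (μ t) / μ` with
`0 < k < d`. In terms of `x = exp (2 μ t)` its `d`-th power is a constant multiple of
`x ^ (k - d) * (x - 1) ^ d`. -/
def IsDegenerateEllipticOfLevel (d : ℕ) (f : ℂ → ℂ) : Prop :=
  ∃ (k : ℕ) (μ : ℂ), 0 < k ∧ k < d ∧ μ ≠ 0 ∧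
    f = fun t => Complex.exp ((2 * k / d - 1) * μ * t) * Complex.sinh (μ * t) / μ

end KricheverGenus

end

/-!
Let `h = 1 / f`, so that the equation says that `∑ k, ∏ i ≠ k, h (u i - u k)` (`hirzebruchSum h u`)
is constant. Both directions rest on viewing the sum as a function `M` of a single argument `z`, the
others being kept at distinct points `v i`:
`M z = ∏ i, h (v i - z) + ∑ k, c k * h (z - v k)` (`hirzebruchSum_insertNth`).
The function `h` has simple poles at the points of a discrete group `Λ`, no other poles, and
`h (z + ω) = χ ω * h z` for `ω ∈ Λ`; here `Λ` is the period lattice, or `ℤ π i / η` for a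
nodal curve.

Suppose that `f` is a solution. By analytic continuation `M` is constant on the whole plane, and
comparing `M z` with `M (z + ω)` gives `χ ω ^ (n + 1) = 1`, because otherwise the first term of `M`,
which has poles, would be constant (`multiplier_pow_eq_one`). For a lattice this means that
`f ^ (n + 1)` is elliptic, so that `f` is elliptic of level `n + 1`. What is needed about the sigma
function is that it is entire, that its zeros are simple and are exactly the lattice points, and
that it is quasi-periodic (`exists_sigma_add`), which follows from the periodicity of `℘ = -(log σ)''`.
For a nodal curve one obtains `lam * (n + 1) = 2 * η * K` with an integer `K`, and the behaviour of
`M` as `exp (2 η z)` tends to infinity (`not_solution_of_tendsto`) leaves exactly the Todd genera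
(`K = 0`, or `q = ± η` and `|K| = n + 1`) and the degenerate elliptic functions of level `n + 1`
(`q = ± η` and `0 < |K| < n + 1`, with matching signs). For a cuspidal curve the same argument gives
`lam = 0`.

Conversely, if `f` is elliptic of level `d ∣ n + 1`, then the multipliers of `h` are `(n + 1)`-st
roots of unity, so `|M|` is `Λ`-periodic; the poles of `M` cancel in pairs
(`tendsto_sub_mul_hirzebruchSum`), hence `M` is constant by Liouville's theorem, and the sum does
not depend on any of its arguments. For the Todd genera and the degenerate elliptic functions the sum is
a rational function of the `exp (c * u i)`, which Lagrange interpolation evaluates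
(`add_mul_sum_prod_div_sub`, `sum_pow_div_prod_sub_eq_zero`); the one-parametric Todd genus is
reached as a limit (`tendsto_one_div_toddFun`).
-/

open Filter Topology

noncomputable section

namespace KricheverGenus

/-! ### The Hirzebruch sum as a function of one argument -/

/-- The left-hand side `∑ k, ∏ i ≠ k, h (u i - u k)` of the Hirzebruch functional equation, in terms
of `h = 1 / f`. -/
def hirzebruchSum (h : ℂ → ℂ) {n : ℕ} (u : Fin n → ℂ) : ℂ :=
  ∑ k, ∏ i ∈ Finset.univ.erase k, h (u i - u k)

theorem prod_erase_eq_prod_ite {ι : Type*} [Fintype ι] [DecidableEq ι] (k : ι) (g : ι → ℂ) :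
    ∏ i ∈ Finset.univ.erase k, g i = ∏ i, if i = k then 1 else g i := by
  rw [← Finset.mul_prod_erase Finset.univ (fun i => if i = k then 1 else g i) (Finset.mem_univ k),
    if_pos rfl, one_mul]
  exact Finset.prod_congr rfl fun i hi => by rw [if_neg (Finset.ne_of_mem_erase hi)]

/-- The dependence of the Hirzebruch sum on one of its arguments. -/
theorem hirzebruchSum_insertNth (h : ℂ → ℂ) {n : ℕ} (j : Fin (n + 1)) (z : ℂ) (v : Fin n → ℂ) :
    hirzebruchSum h (j.insertNth z v : Fin (n + 1) → ℂ) =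
      ∏ i, h (v i - z) +
        ∑ k, (∏ i ∈ Finset.univ.erase k, h (v i - v k)) * h (z - v k) := by
  unfold hirzebruchSum
  simp only [prod_erase_eq_prod_ite]
  rw [Fin.sum_univ_succAbove _ j]
  congr 1
  · rw [Fin.prod_univ_succAbove _ j]
    simp
  · refine Finset.sum_congr rfl fun k _ => ?_
    rw [Fin.prod_univ_succAbove _ j]
    simp [mul_comm]

theorem differentiableAt_hirzebruchSum_insertNth {h : ℂ → ℂ} {Λ : AddSubgroup ℂ}
    (hd : ∀ z ∉ Λ, DifferentiableAt ℂ h z) {n : ℕ} (j : Fin (n + 1)) (v : Fin n → ℂ) {z : ℂ}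
    (hz : ∀ i, z - v i ∉ Λ) :
    DifferentiableAt ℂ (fun z => hirzebruchSum h (j.insertNth z v : Fin (n + 1) → ℂ)) z := by
  simp only [hirzebruchSum_insertNth]
  refine .add (.fun_finsetProd fun i _ => ?_) (.fun_sum fun k _ => .const_mul ?_ _)
  · refine DifferentiableAt.comp (f := fun z => v i - z) z (hd _ fun hi => hz i ?_) (by fun_prop)
    simpa using neg_mem hi
  · exact DifferentiableAt.comp (f := fun z => z - v k) z (hd _ (hz k)) (by fun_prop)

theorem setOf_sub_mem_eq_iUnion_preimage {n : ℕ} (Λ : AddSubgroup ℂ) (v : Fin n → ℂ) :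
    {z : ℂ | ∃ i, z - v i ∈ Λ} = ⋃ i, (fun z => z - v i) ⁻¹' (Λ : Set ℂ) := by
  ext z; simp

theorem isClosed_setOf_exists_sub_mem {Λ : AddSubgroup ℂ} (hc : IsClosed (Λ : Set ℂ)) {n : ℕ}
    (v : Fin n → ℂ) : IsClosed {z : ℂ | ∃ i, z - v i ∈ Λ} := by
  rw [setOf_sub_mem_eq_iUnion_preimage]
  exact isClosed_iUnion_of_finite fun i => hc.preimage (by fun_prop)

theorem countable_setOf_exists_sub_mem {Λ : AddSubgroup ℂ} (hc : (Λ : Set ℂ).Countable) {n : ℕ}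
    (v : Fin n → ℂ) : {z : ℂ | ∃ i, z - v i ∈ Λ}.Countable := by
  rw [setOf_sub_mem_eq_iUnion_preimage]
  exact Set.countable_iUnion fun i => hc.preimage (sub_left_injective)

theorem isPreconnected_compl_of_countable {s : Set ℂ} (hs : s.Countable) : IsPreconnected sᶜ :=
  (hs.isConnected_compl_of_one_lt_rank (by simp)).isPreconnected

/-- Analytic continuation of the functional equation in one variable: if the Hirzebruch sum is
constant near the origin, then it has the same value when all arguments but one are kept at suitable
distinct points near the origin and the remaining one is arbitrary. -/
theorem exists_forall_hirzebruchSum_insertNth_eq {h : ℂ → ℂ} {Λ : AddSubgroup ℂ}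
    (hcl : IsClosed (Λ : Set ℂ)) (hct : (Λ : Set ℂ).Countable)
    (hd : ∀ z ∉ Λ, DifferentiableAt ℂ h z) {n : ℕ} {C : ℂ}
    (hC : ∀ᶠ u : Fin (n + 1) → ℂ in 𝓝 0, Function.Injective u → hirzebruchSum h u = C)
    {ε : ℝ} (hε : 0 < ε) :
    ∃ v : Fin n → ℂ, Function.Injective v ∧ (∀ i, ‖v i‖ < ε) ∧
      ∀ z, (∀ i, z - v i ∉ Λ) →
        hirzebruchSum h ((0 : Fin (n + 1)).insertNth z v : Fin (n + 1) → ℂ) = C := by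
  obtain ⟨r, hr, hball⟩ := Metric.eventually_nhds_iff.1 hC
  obtain ⟨δ, hδ, hδr⟩ : ∃ δ : ℝ, 0 < δ ∧ δ * (n + 1) < min r ε :=
    ⟨min r ε / (n + 2), by positivity, by
      rw [div_mul_eq_mul_div, div_lt_iff₀ (by positivity)]
      have : 0 < min r ε := lt_min hr hε
      nlinarith⟩
  have hv : ∀ i : Fin n, ‖((δ * (i + 1) : ℝ) : ℂ)‖ < min r ε := fun i => by
    rw [Complex.norm_of_nonneg (by positivity)]
    refine lt_of_le_of_lt ?_ hδr
    have : (i : ℝ) ≤ n := by exact_mod_cast i.2.le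
    gcongr
  have hvi : Function.Injective fun i : Fin n => ((δ * (i + 1) : ℝ) : ℂ) := fun i k hik => by
    have : (i : ℝ) = k := by
      have := Complex.ofReal_injective hik
      simpa [hδ.ne'] using this
    exact Fin.ext (by exact_mod_cast this)
  refine ⟨fun i => ((δ * (i + 1) : ℝ) : ℂ), hvi,
    fun i => (hv i).trans_le (min_le_right _ _), ?_⟩
  set v : Fin n → ℂ := fun i => ((δ * (i + 1) : ℝ) : ℂ) with hvdef
  set S : Set ℂ := {z : ℂ | ∃ i, z - v i ∈ Λ}
  have hSo : IsOpen Sᶜ := (isClosed_setOf_exists_sub_mem hcl v).isOpen_compl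
  have hSc : S.Countable := countable_setOf_exists_sub_mem hct v
  -- near a point of the complement of `S` inside the ball of radius `r`, the equation is given
  obtain ⟨z₀, hz₀S, hz₀⟩ : ∃ z₀ ∈ Sᶜ, ‖z₀‖ < r := by
    have := (hSc.dense_compl ℝ).inter_open_nonempty (Metric.ball 0 r) Metric.isOpen_ball
      ⟨0, by simpa using hr⟩
    obtain ⟨z, hz, hz'⟩ := this
    exact ⟨z, hz', by simpa using hz⟩
  have hM : AnalyticOnNhd ℂ
      (fun z => hirzebruchSum h ((0 : Fin (n + 1)).insertNth z v : Fin (n + 1) → ℂ)) Sᶜ := by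
    refine DifferentiableOn.analyticOnNhd (fun z hz => ?_) hSo
    exact (differentiableAt_hirzebruchSum_insertNth hd 0 v
      (fun i hi => hz ⟨i, hi⟩)).differentiableWithinAt
  have hloc : (fun z => hirzebruchSum h ((0 : Fin (n + 1)).insertNth z v : Fin (n + 1) → ℂ))
      =ᶠ[𝓝 z₀] fun _ => C := by
    filter_upwards [hSo.mem_nhds hz₀S, Metric.isOpen_ball.mem_nhds
      (show z₀ ∈ Metric.ball (0 : ℂ) r by simpa using hz₀)] with z hz hzr
    refine hball ?_ ?_
    · rw [dist_zero_right, pi_norm_lt_iff hr]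
      refine fun i => Fin.succAboveCases 0 ?_ (fun k => ?_) i
      · simpa using hzr
      · simp only [Fin.succAbove_zero, Fin.insertNth_zero', Fin.cons_succ]
        exact (hv k).trans_le (min_le_left _ _)
    · rw [Fin.insertNth_zero', Fin.cons_injective_iff]
      refine ⟨?_, hvi⟩
      rintro ⟨i, hi⟩
      exact hz ⟨i, by simp [← hi, zero_mem]⟩
  intro z hz
  exact hM.eqOn_of_preconnected_of_eventuallyEq analyticOnNhd_const
    (isPreconnected_compl_of_countable hSc) hz₀S hloc (fun ⟨i, hi⟩ => hz i hi)

/-- The multiplier of a quasi-period of a solution is an `(n + 1)`-st root of unity: otherwise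
comparing the equation at `z` and `z + ω` would make the term `∏ i, h (v i - z)`, which has poles,
constant. -/
theorem multiplier_pow_eq_one {h : ℂ → ℂ} {Λ : AddSubgroup ℂ}
    (hcl : IsClosed (Λ : Set ℂ)) (hct : (Λ : Set ℂ).Countable)
    (hd : ∀ z ∉ Λ, DifferentiableAt ℂ h z)
    (hinf : Tendsto (fun z => ‖h z‖) (𝓝[≠] 0) atTop) {n : ℕ} (hn : 1 ≤ n) {C : ℂ}
    (hC : ∀ᶠ u : Fin (n + 1) → ℂ in 𝓝 0, Function.Injective u → hirzebruchSum h u = C)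
    {ω χ : ℂ} (hω : ω ∈ Λ) (hχ : χ ≠ 0) (hper : ∀ z, h (z + ω) = χ * h z) :
    χ ^ (n + 1) = 1 := by
  by_contra hne
  obtain ⟨ε, hε, hbig⟩ := Metric.eventually_nhds_iff.1
    (eventually_nhdsWithin_iff.1 (hinf.eventually_ge_atTop 1))
  obtain ⟨v, hvi, hvε, hv⟩ := exists_forall_hirzebruchSum_insertNth_eq hcl hct hd hC (half_pos hε)
  have hper' : ∀ z, h (z - ω) = χ⁻¹ * h z := fun z => by
    have := hper (z - ω)
    rw [sub_add_cancel] at this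
    rw [this, inv_mul_cancel_left₀ hχ]
  have hT : ∀ z, (∀ i, z - v i ∉ Λ) →
      ∏ i, h (v i - z) = C * (1 - χ) * χ ^ n / (1 - χ ^ (n + 1)) := by
    intro z hz
    have h1 := hv z hz
    have h2 := hv (z + ω) (fun i hi => hz i (by
      simpa [add_sub_right_comm] using Λ.sub_mem hi hω))
    rw [hirzebruchSum_insertNth] at h1 h2
    simp only [add_sub_right_comm _ ω, hper, ← sub_sub, hper', Finset.prod_mul_distrib,
      Finset.prod_const, Finset.card_univ, Fintype.card_fin, mul_left_comm _ χ,
      ← Finset.mul_sum] at h2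
    rw [eq_div_iff (sub_ne_zero.2 (Ne.symm hne))]
    have h3 : χ ^ n * χ⁻¹ ^ n = 1 := by rw [← mul_pow, mul_inv_cancel₀ hχ, one_pow]
    linear_combination χ ^ n * h2 - χ ^ (n + 1) * h1 - (∏ i, h (v i - z)) * h3
  set i₀ : Fin n := ⟨0, hn⟩
  set S : Set ℂ := {z : ℂ | ∃ i, z - v i ∈ Λ}
  have hSd : Dense Sᶜ := (countable_setOf_exists_sub_mem hct v).dense_compl ℝ
  -- the points of the complement of `S` accumulate at `v i₀`, where the product blows up
  have hfreq : ∃ᶠ z in 𝓝[≠] (v i₀), z ∈ Sᶜ := by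
    have : ∃ᶠ z in 𝓝 (v i₀), z ∈ Sᶜ := mem_closure_iff_frequently.1 (hSd _)
    rw [frequently_nhdsWithin_iff]
    refine this.mono fun z hz => ⟨hz, fun hzv => hz ⟨i₀, ?_⟩⟩
    simp [show z = v i₀ from hzv, zero_mem]
  have hlim : Tendsto (fun z => ‖h (v i₀ - z)‖) (𝓝[≠] (v i₀)) atTop := by
    refine hinf.comp (tendsto_nhdsWithin_iff.2 ⟨?_, ?_⟩)
    · have : Tendsto (fun z => v i₀ - z) (𝓝 (v i₀)) (𝓝 (v i₀ - v i₀)) :=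
        Continuous.tendsto (by fun_prop) _
      rw [sub_self] at this
      exact this.mono_left nhdsWithin_le_nhds
    · filter_upwards [self_mem_nhdsWithin] with z hz
      exact sub_ne_zero.2 (Ne.symm hz)
  have hball : ∀ᶠ z in 𝓝[≠] (v i₀), ‖z‖ < ε / 2 := nhdsWithin_le_nhds
    (continuous_norm.continuousAt.eventually (gt_mem_nhds (hvε i₀)))
  obtain ⟨z, hzS, hz1, hz2⟩ := (hfreq.and_eventually ((hlim.eventually_gt_atTop
    ‖C * (1 - χ) * χ ^ n / (1 - χ ^ (n + 1))‖).and hball)).exists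
  rw [← hT z fun i hi => hzS ⟨i, hi⟩, norm_prod,
    ← Finset.mul_prod_erase Finset.univ _ (Finset.mem_univ i₀)] at hz1
  refine absurd hz1 (not_lt.2 (le_mul_of_one_le_right (norm_nonneg _) ?_))
  refine Finset.one_le_prod fun i _ => hbig ?_ ?_
  · rw [dist_zero_right]
    calc ‖v i - z‖ ≤ ‖v i‖ + ‖z‖ := norm_sub_le _ _
      _ < ε / 2 + ε / 2 := add_lt_add (hvε i) hz2
      _ = ε := add_halves ε
  · exact fun h0 => hzS ⟨i, by simp [sub_eq_zero.1 h0, zero_mem]⟩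

/-- A function that tends to zero in one direction and to infinity in the opposite one is not a
solution. -/
theorem not_solution_of_tendsto {h : ℂ → ℂ} {Λ : AddSubgroup ℂ}
    (hcl : IsClosed (Λ : Set ℂ)) (hct : (Λ : Set ℂ).Countable)
    (hd : ∀ z ∉ Λ, DifferentiableAt ℂ h z) {n : ℕ} (hn : 1 ≤ n) {C : ℂ}
    (hC : ∀ᶠ u : Fin (n + 1) → ℂ in 𝓝 0, Function.Injective u → hirzebruchSum h u = C)
    {a : ℂ} (ha : ∀ c, ∀ᶠ r : ℝ in atTop, r * a + c ∉ Λ)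
    (hzero : ∀ c, Tendsto (fun r : ℝ => h (r * a + c)) atTop (𝓝 0))
    (hinf : ∀ c, Tendsto (fun r : ℝ => ‖h (c - r * a)‖) atTop atTop) : False := by
  obtain ⟨v, -, -, hv⟩ := exists_forall_hirzebruchSum_insertNth_eq hcl hct hd hC one_pos
  have h1 : Tendsto (fun r : ℝ => ∑ k, (∏ i ∈ Finset.univ.erase k, h (v i - v k)) *
      h (r * a - v k)) atTop (𝓝 0) := by
    have := tendsto_finsetSum (f := fun k (r : ℝ) =>
      (∏ i ∈ Finset.univ.erase k, h (v i - v k)) * h (r * a - v k)) Finset.univ fun k _ =>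
      (hzero (- v k)).const_mul (∏ i ∈ Finset.univ.erase k, h (v i - v k))
    simpa [sub_eq_add_neg] using this
  have h2 : Tendsto (fun r : ℝ => ∏ i, h (v i - r * a)) atTop (𝓝 C) := by
    have h3 := h1.const_sub C
    rw [sub_zero] at h3
    refine h3.congr' ?_
    filter_upwards [eventually_all.2 fun i => ha (- v i)] with r hr
    have := hv (r * a) (by simpa [sub_eq_add_neg] using hr)
    rw [hirzebruchSum_insertNth] at this
    linear_combination -this
  set i₀ : Fin n := ⟨0, hn⟩
  refine not_tendsto_nhds_of_tendsto_atTop (tendsto_atTop_mono' _ ?_ (hinf (v i₀))) _ h2.norm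
  filter_upwards [eventually_all.2 fun i => (hinf (v i)).eventually_ge_atTop 1] with r hr
  rw [norm_prod, ← Finset.mul_prod_erase Finset.univ _ (Finset.mem_univ i₀)]
  exact le_mul_of_one_le_right (norm_nonneg _) (Finset.one_le_prod fun i _ => hr i)

/-! ### Independence of the arguments under root-of-unity multipliers -/

/-- Riemann's theorem on removable singularities for a discrete set of singularities. -/
theorem exists_differentiable_extension {M : ℂ → ℂ} {D : Set ℂ}
    (hiso : ∀ c, ∀ᶠ z in 𝓝[≠] c, z ∉ D) (hd : ∀ z ∉ D, DifferentiableAt ℂ M z)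
    (hlim : ∀ c ∈ D, Tendsto (fun z => (z - c) * M z) (𝓝[≠] c) (𝓝 0)) :
    ∃ E : ℂ → ℂ, Differentiable ℂ E ∧ ∀ z ∉ D, E z = M z := by
  have hE : ∀ z ∉ D, limUnder (𝓝[≠] z) M = M z := fun z hz =>
    ((hd z hz).continuousAt.tendsto.mono_left nhdsWithin_le_nhds).limUnder_eq
  refine ⟨fun z => limUnder (𝓝[≠] z) M, fun c => ?_, hE⟩
  have hs : {z | z ≠ c → z ∉ D} ∈ 𝓝 c := eventually_nhdsWithin_iff.1 (hiso c)
  have hlim' : Tendsto (fun z => (z - c) * (M z - M c)) (𝓝[≠] c) (𝓝 0) := by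
    have hz : Tendsto (fun z => (z - c)) (𝓝[≠] c) (𝓝 0) := by
      have : Tendsto (fun z => z - c) (𝓝 c) (𝓝 (c - c)) := Continuous.tendsto (by fun_prop) _
      rw [sub_self] at this
      exact this.mono_left nhdsWithin_le_nhds
    have h1 : Tendsto (fun z => (z - c) * M z) (𝓝[≠] c) (𝓝 0) := by
      by_cases hc : c ∈ D
      · exact hlim c hc
      · simpa using hz.mul ((hd c hc).continuousAt.tendsto.mono_left nhdsWithin_le_nhds)
    simpa [mul_sub] using h1.sub (hz.mul_const (M c))
  have ho : (fun z => M z - M c) =o[𝓝[≠] c] fun z => (z - c)⁻¹ := by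
    rw [Asymptotics.isLittleO_iff_tendsto']
    · refine hlim'.congr fun z => ?_
      rw [div_inv_eq_mul, mul_comm]
    · filter_upwards [self_mem_nhdsWithin] with z hz h0
      exact absurd (inv_eq_zero.1 h0) (sub_ne_zero.2 hz)
  have := Complex.differentiableOn_update_limUnder_of_isLittleO hs
    (fun z hz => (hd z (hz.1 hz.2)).differentiableWithinAt) ho
  refine (this.differentiableAt hs).congr_of_eventuallyEq ?_
  filter_upwards [hs] with z hz
  by_cases hzc : z = c
  · rw [hzc, Function.update_self]
  · rw [Function.update_of_ne hzc, hE z (hz hzc)]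

/-- The poles of the Hirzebruch sum on the diagonal cancel: the term with index `m` and the term
whose index is that of the variable argument have opposite residues at `v m`. -/
theorem tendsto_sub_mul_hirzebruchSum {h : ℂ → ℂ} {Λ : AddSubgroup ℂ}
    (hd : ∀ z ∉ Λ, DifferentiableAt ℂ h z)
    (hres : Tendsto (fun z => z * h z) (𝓝[≠] 0) (𝓝 1)) {n : ℕ} (j : Fin (n + 1))
    {v : Fin n → ℂ} (hv : ∀ i k, i ≠ k → v i - v k ∉ Λ) (m : Fin n) :
    Tendsto (fun z => (z - v m) * hirzebruchSum h (j.insertNth z v : Fin (n + 1) → ℂ))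
      (𝓝[≠] (v m)) (𝓝 0) := by
  have hz : Tendsto (fun z => (z - v m)) (𝓝[≠] (v m)) (𝓝[≠] 0) := by
    refine tendsto_nhdsWithin_iff.2 ⟨?_, ?_⟩
    · have : Tendsto (fun z => z - v m) (𝓝 (v m)) (𝓝 (v m - v m)) :=
        Continuous.tendsto (by fun_prop) _
      rw [sub_self] at this
      exact this.mono_left nhdsWithin_le_nhds
    · filter_upwards [self_mem_nhdsWithin] with z hz
      exact sub_ne_zero.2 hz
  have hz' : Tendsto (fun z => (v m - z)) (𝓝[≠] (v m)) (𝓝[≠] 0) := by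
    refine tendsto_nhdsWithin_iff.2 ⟨?_, ?_⟩
    · simpa using (hz.mono_right nhdsWithin_le_nhds).neg
    · filter_upwards [self_mem_nhdsWithin] with z hz
      exact sub_ne_zero.2 (Ne.symm hz)
  have hterm : ∀ k, Tendsto (fun z => (z - v m) *
      ((∏ i ∈ Finset.univ.erase k, h (v i - v k)) * h (z - v k))) (𝓝[≠] (v m))
      (𝓝 (if k = m then ∏ i ∈ Finset.univ.erase m, h (v i - v m) else 0)) := by
    intro k
    by_cases hk : k = m
    · subst hk
      simp only [if_pos, mul_left_comm (_ - _)]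
      simpa using (hres.comp hz).const_mul (∏ i ∈ Finset.univ.erase k, h (v i - v k))
    · rw [if_neg hk]
      have hc : ContinuousAt (fun z => h (z - v k)) (v m) :=
        ContinuousAt.comp (f := fun z => z - v k) (hd _ (hv m k (Ne.symm hk))).continuousAt
          (by fun_prop)
      simpa using (hz.mono_right nhdsWithin_le_nhds).mul
        ((hc.tendsto.mono_left nhdsWithin_le_nhds).const_mul
          (∏ i ∈ Finset.univ.erase k, h (v i - v k)))
  have hsum := tendsto_finsetSum Finset.univ fun k _ => hterm k
  have hprod : Tendsto (fun z => (z - v m) * ∏ i, h (v i - z)) (𝓝[≠] (v m))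
      (𝓝 (-∏ i ∈ Finset.univ.erase m, h (v i - v m))) := by
    have h1 : Tendsto (fun z => ∏ i ∈ Finset.univ.erase m, h (v i - z)) (𝓝[≠] (v m))
        (𝓝 (∏ i ∈ Finset.univ.erase m, h (v i - v m))) := by
      refine tendsto_finsetProd _ fun i hi => ?_
      have hc : ContinuousAt (fun z => h (v i - z)) (v m) :=
        ContinuousAt.comp (f := fun z => v i - z)
          (hd _ (hv i m (Finset.ne_of_mem_erase hi))).continuousAt (by fun_prop)
      exact hc.tendsto.mono_left nhdsWithin_le_nhds
    have h2 := (hres.comp hz').neg.mul h1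
    rw [neg_one_mul] at h2
    refine h2.congr fun z => ?_
    rw [← Finset.mul_prod_erase Finset.univ _ (Finset.mem_univ m)]
    simp only [Function.comp]
    ring
  have := hprod.add hsum
  rw [Finset.sum_ite_eq' Finset.univ m, if_pos (Finset.mem_univ m), neg_add_cancel] at this
  refine this.congr fun z => ?_
  rw [hirzebruchSum_insertNth, mul_add, Finset.mul_sum]

/-- If `h` is quasi-periodic with respect to a lattice `Λ`, its multipliers are `(n + 1)`-st roots
of unity, and its only poles are simple ones at the lattice points, then the Hirzebruch sum does not
depend on its `j`-th argument: as a function of it, it extends to a bounded entire function. -/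
theorem exists_forall_hirzebruchSum_insertNth_eq_of_multiplier {h : ℂ → ℂ} {Λ : AddSubgroup ℂ}
    (hiso : ∀ c, ∀ᶠ z in 𝓝[≠] c, z ∉ Λ) (hct : (Λ : Set ℂ).Countable) {K : Set ℂ}
    (hK : IsCompact K) (hKΛ : ∀ z, ∃ l ∈ Λ, z + l ∈ K)
    (hd : ∀ z ∉ Λ, DifferentiableAt ℂ h z)
    (hres : Tendsto (fun z => z * h z) (𝓝[≠] 0) (𝓝 1)) {n : ℕ}
    (hper : ∀ ω ∈ Λ, ∃ χ : ℂ, χ ^ (n + 1) = 1 ∧ ∀ z ∉ Λ, h (z + ω) = χ * h z)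
    (j : Fin (n + 1)) {v : Fin n → ℂ} (hv : ∀ i k, i ≠ k → v i - v k ∉ Λ) :
    ∃ c, ∀ z, (∀ i, z - v i ∉ Λ) →
      hirzebruchSum h (j.insertNth z v : Fin (n + 1) → ℂ) = c := by
  set M : ℂ → ℂ := fun z => hirzebruchSum h (j.insertNth z v : Fin (n + 1) → ℂ)
  set S : Set ℂ := {z : ℂ | ∃ i, z - v i ∈ Λ} with hS
  have hSmem : ∀ z, z ∉ S ↔ ∀ i, z - v i ∉ Λ := fun z => by simp [hS]
  have hSiso : ∀ c, ∀ᶠ z in 𝓝[≠] c, z ∉ S := by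
    intro c
    simp only [hSmem]
    refine eventually_all.2 fun i => ?_
    have hz : Tendsto (fun z => (z - v i)) (𝓝[≠] c) (𝓝[≠] (c - v i)) := by
      refine tendsto_nhdsWithin_iff.2 ⟨?_, ?_⟩
      · exact (Continuous.tendsto (by fun_prop) _).mono_left nhdsWithin_le_nhds
      · filter_upwards [self_mem_nhdsWithin] with z hz
        simpa using hz
    exact hz.eventually (hiso _)
  have hSadd : ∀ ω ∈ Λ, ∀ z, z ∉ S → z + ω ∉ S := by
    intro ω hω z hz ⟨i, hi⟩
    refine hz ⟨i, ?_⟩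
    have := Λ.sub_mem hi hω
    rwa [add_sub_right_comm, add_sub_cancel_right] at this
  have hMper : ∀ ω ∈ Λ, ∃ χ : ℂ, ‖χ‖ = 1 ∧ ∀ z ∉ S, M (z + ω) = χ * M z := by
    intro ω hω
    obtain ⟨χ, hχ, hχh⟩ := hper ω hω
    have hχ0 : χ ≠ 0 := fun h0 => by simp [h0] at hχ
    refine ⟨χ, Complex.norm_eq_one_of_pow_eq_one hχ n.succ_ne_zero, fun z hz => ?_⟩
    rw [hSmem] at hz
    have h1 : ∀ i, h (v i - z - ω) = χ⁻¹ * h (v i - z) := fun i => by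
      have := hχh (v i - z - ω) (fun hi => hz i (by
        simpa using neg_mem (Λ.add_mem hi hω)))
      rw [sub_add_cancel] at this
      rw [this, inv_mul_cancel_left₀ hχ0]
    have h2 : χ⁻¹ ^ n = χ := by
      rw [inv_pow]
      exact inv_eq_of_mul_eq_one_right (by rw [← pow_succ, hχ])
    simp only [M, hirzebruchSum_insertNth, ← sub_sub, h1, add_sub_right_comm _ ω,
      fun k => hχh _ (hz k), Finset.prod_mul_distrib, Finset.prod_const, Finset.card_univ,
      Fintype.card_fin, h2, mul_add, Finset.mul_sum, mul_left_comm _ χ]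
  obtain ⟨E, hEd, hEM⟩ := exists_differentiable_extension (M := M) hSiso
    (fun z hz => differentiableAt_hirzebruchSum_insertNth hd j v ((hSmem z).1 hz)) (by
      rintro c ⟨m, hm⟩
      obtain ⟨χ, -, hχ⟩ := hMper _ hm
      have hz : Tendsto (fun z => (z - (c - v m))) (𝓝[≠] c) (𝓝[≠] (v m)) := by
        refine tendsto_nhdsWithin_iff.2 ⟨?_, ?_⟩
        · have : Tendsto (fun z => z - (c - v m)) (𝓝 c) (𝓝 (c - (c - v m))) :=
            Continuous.tendsto (by fun_prop) _
          rw [sub_sub_cancel] at this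
          exact this.mono_left nhdsWithin_le_nhds
        · filter_upwards [self_mem_nhdsWithin] with z hz h0
          have h1 : z - (c - v m) = v m := h0
          exact hz (show z = c by linear_combination h1)
      have h1 := ((tendsto_sub_mul_hirzebruchSum hd hres j hv m).comp hz).const_mul χ
      rw [mul_zero] at h1
      refine h1.congr' ?_
      filter_upwards [hSiso c] with z hzS
      have h2 := hSadd _ (neg_mem hm) z hzS
      rw [← sub_eq_add_neg] at h2
      have h3 := hχ _ h2
      rw [sub_add_cancel] at h3
      simp only [Function.comp]
      rw [h3]
      ring)
  have hdense : Dense Sᶜ := (countable_setOf_exists_sub_mem hct v).dense_compl ℝ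
  have hEper : ∀ ω ∈ Λ, ∀ z, ‖E (z + ω)‖ = ‖E z‖ := by
    intro ω hω
    obtain ⟨χ, hχ1, hχ⟩ := hMper ω hω
    refine congrFun (Continuous.ext_on hdense ?_ ?_ fun z hz => ?_)
    · exact (hEd.continuous.comp (by fun_prop)).norm
    · exact hEd.continuous.norm
    · rw [hEM _ hz, hEM _ (hSadd ω hω z hz), hχ z hz, norm_mul, hχ1, one_mul]
  obtain ⟨B, hB⟩ := hK.exists_bound_of_continuousOn hEd.continuous.continuousOn
  have hbdd : Bornology.IsBounded (Set.range E) := by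
    refine isBounded_iff_forall_norm_le.2 ⟨B, ?_⟩
    rintro _ ⟨z, rfl⟩
    obtain ⟨l, hl, hlK⟩ := hKΛ z
    rw [← hEper l hl]
    exact hB _ hlK
  refine ⟨E 0, fun z hz => ?_⟩
  rw [← hEd.apply_eq_apply_of_bounded hbdd z 0]
  exact (hEM z ((hSmem z).2 hz)).symm

/-- A function of tuples that is unchanged when one coordinate is modified is constant on the tuples
of distinct points of an infinite set. -/
theorem apply_eq_of_forall_update {α β : Type*} {m : ℕ} {U : Set α} (hU : U.Infinite)
    (F : (Fin m → α) → β)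
    (hF : ∀ (u : Fin m → α) (j : Fin m) (a : α), (∀ i, u i ∈ U) → a ∈ U → Function.Injective u →
      (∀ i, a ≠ u i) → F (Function.update u j a) = F u)
    {u w : Fin m → α} (hu : ∀ i, u i ∈ U) (hw : ∀ i, w i ∈ U) (hui : Function.Injective u)
    (hwi : Function.Injective w) : F u = F w := by
  -- it suffices to pass between tuples without common values
  have key : ∀ u w : Fin m → α, (∀ i, u i ∈ U) → (∀ i, w i ∈ U) → Function.Injective u →
      Function.Injective w → (∀ i k, w i ≠ u k) → F u = F w := by
    intro u w hu hw hui hwi hne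
    set y : ℕ → Fin m → α := fun t i => if i.val < t then w i else u i with hy
    have hyU : ∀ t i, y t i ∈ U := fun t i => by
      simp only [hy]; split_ifs; exacts [hw i, hu i]
    have hyi : ∀ t, Function.Injective (y t) := by
      intro t i k hik
      simp only [hy] at hik
      split_ifs at hik
      exacts [hwi hik, absurd hik (hne _ _), absurd hik.symm (hne _ _), hui hik]
    have hstep : ∀ t, t ≤ m → F (y t) = F u := by
      intro t
      induction t with
      | zero => intro _; congr 1
      | succ t ih =>
        intro ht
        rw [← ih (by omega)]
        have : y (t + 1) = Function.update (y t) ⟨t, ht⟩ (w ⟨t, ht⟩) := by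
          funext i
          rcases eq_or_ne i ⟨t, ht⟩ with rfl | hi
          · simp [hy]
          · rw [Function.update_of_ne hi]
            have : i.val ≠ t := fun h => hi (Fin.ext h)
            simp only [hy]
            congr 1
            simp only [eq_iff_iff]
            omega
        rw [this]
        refine hF _ _ _ (hyU t) (hw _) (hyi t) fun i => ?_
        simp only [hy]
        split_ifs with hi
        · exact fun h => absurd (hwi h) (by rintro rfl; simp at hi)
        · exact hne _ _
    rw [← hstep m le_rfl]
    congr 1
    funext i
    simp [hy]
  have hfin : (Set.range u ∪ Set.range w).Finite := (Set.finite_range u).union (Set.finite_range w)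
  have hinf := hU.sdiff hfin
  have := hinf.to_subtype
  let e := Infinite.natEmbedding ↥(U \ (Set.range u ∪ Set.range w))
  set x : Fin m → α := fun i => (e i : α)
  have hxi : Function.Injective x := fun i k hik =>
    Fin.ext (e.injective (Subtype.ext hik))
  have hxU : ∀ i, x i ∈ U := fun i => (e i).2.1
  rw [key u x hu hxU hui hxi fun i k hik => (e i).2.2 (Or.inl ⟨k, hik.symm⟩),
    key w x hw hxU hwi hxi fun i k hik => (e i).2.2 (Or.inr ⟨k, hik.symm⟩)]

/-- A function with simple poles at the points of a lattice, no other poles, and multipliers that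
are `(n + 1)`-st roots of unity solves the functional equation. -/
theorem exists_eventually_hirzebruchSum_eq_of_multiplier {h : ℂ → ℂ} {Λ : AddSubgroup ℂ}
    (hiso : ∀ c, ∀ᶠ z in 𝓝[≠] c, z ∉ Λ) (hct : (Λ : Set ℂ).Countable) {K : Set ℂ}
    (hK : IsCompact K) (hKΛ : ∀ z, ∃ l ∈ Λ, z + l ∈ K)
    (hd : ∀ z ∉ Λ, DifferentiableAt ℂ h z)
    (hres : Tendsto (fun z => z * h z) (𝓝[≠] 0) (𝓝 1)) {n : ℕ}
    (hper : ∀ ω ∈ Λ, ∃ χ : ℂ, χ ^ (n + 1) = 1 ∧ ∀ z ∉ Λ, h (z + ω) = χ * h z) :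
    ∃ C, ∀ᶠ u : Fin (n + 1) → ℂ in 𝓝 0, Function.Injective u → hirzebruchSum h u = C := by
  obtain ⟨ε, hε, hball⟩ := Metric.eventually_nhds_iff.1 (eventually_nhdsWithin_iff.1 (hiso 0))
  set U : Set ℂ := Metric.ball 0 (ε / 2)
  have hUΛ : ∀ a ∈ U, ∀ b ∈ U, a ≠ b → a - b ∉ Λ := fun a ha b hb hab => by
    refine hball ?_ (sub_ne_zero.2 hab)
    rw [dist_zero_right]
    have ha' : ‖a‖ < ε / 2 := by simpa [U] using ha
    have hb' : ‖b‖ < ε / 2 := by simpa [U] using hb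
    linarith [norm_sub_le a b]
  have hUinf : U.Infinite := infinite_of_mem_nhds 0 (Metric.ball_mem_nhds 0 (half_pos hε))
  have hF : ∀ (u : Fin (n + 1) → ℂ) (j : Fin (n + 1)) (a : ℂ), (∀ i, u i ∈ U) → a ∈ U →
      Function.Injective u → (∀ i, a ≠ u i) →
      hirzebruchSum h (Function.update u j a) = hirzebruchSum h u := by
    intro u j a hu ha hui hau
    obtain ⟨c, hc⟩ := exists_forall_hirzebruchSum_insertNth_eq_of_multiplier hiso hct hK hKΛ hd
      hres hper j (v := j.removeNth u) fun i k hik =>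
        hUΛ _ (hu _) _ (hu _) (hui.ne (Fin.succAbove_right_injective.ne hik))
    have h1 := hc a fun i => hUΛ _ ha _ (hu _) (hau _)
    have h2 := hc (u j) fun i => hUΛ _ (hu _) _ (hu _) (hui.ne (Fin.succAbove_ne j i).symm)
    rw [Fin.insertNth_self_removeNth] at h2
    rw [Fin.insertNth_removeNth] at h1
    rw [h1, h2]
  have hnhds : ∀ᶠ u : Fin (n + 1) → ℂ in 𝓝 0, ∀ i, u i ∈ U := by
    filter_upwards [Metric.ball_mem_nhds (0 : Fin (n + 1) → ℂ) (half_pos hε)] with u hu i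
    rw [mem_ball_zero_iff, pi_norm_lt_iff (half_pos hε)] at hu
    simpa [U] using hu i
  have := hUinf.to_subtype
  let e := Infinite.natEmbedding ↥U
  refine ⟨hirzebruchSum h fun i : Fin (n + 1) => (e i : ℂ), ?_⟩
  filter_upwards [hnhds] with u hu hui
  exact apply_eq_of_forall_update hUinf _ hF hu (fun i => (e i).2) hui fun i k hik =>
    Fin.ext (e.injective (Subtype.ext hik))

/-! ### The Weierstrass sigma function -/

/-- The factor of the product of the sigma function that belongs to a lattice point `l ≠ 0`, and
`1` for `l = 0`. -/
def sigmaFactor (l z : ℂ) : ℂ := (1 - z / l) * Complex.exp (z / l + z ^ 2 / (2 * l ^ 2))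

/-- The product `σ(z) / z`. -/
def sigmaProduct (L : PeriodPair) (z : ℂ) : ℂ := ∏' l : L.lattice, sigmaFactor l z

/-- The function `ζ(z) - 1 / z`, as a series whose summand at `l = 0` is omitted. -/
def zetaExcept (L : PeriodPair) (z : ℂ) : ℂ :=
  ∑' l : L.lattice, if (l : ℂ) = 0 then 0 else 1 / (z - l) + 1 / (l : ℂ) + z / (l : ℂ) ^ 2

theorem sigma_eq (L : PeriodPair) (z : ℂ) : sigma L z = z * sigmaProduct L z := rfl

@[simp] theorem sigmaFactor_zero_left (z : ℂ) : sigmaFactor 0 z = 1 := by simp [sigmaFactor]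

@[simp] theorem sigmaFactor_zero_right (l : ℂ) : sigmaFactor l 0 = 1 := by simp [sigmaFactor]

theorem differentiable_sigmaFactor (l : ℂ) : Differentiable ℂ (sigmaFactor l) := by
  unfold sigmaFactor; fun_prop

theorem sigmaFactor_ne_zero {l z : ℂ} (h : z ≠ l) : sigmaFactor l z ≠ 0 := by
  by_cases hl : l = 0
  · simp [hl]
  · refine mul_ne_zero (sub_ne_zero.2 fun h1 => h ?_) (Complex.exp_ne_zero _)
    rw [eq_comm, div_eq_one_iff_eq hl] at h1
    exact h1

theorem norm_one_sub_mul_exp_sub_one_le {w : ℂ} (hw : ‖w‖ ≤ 1 / 2) :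
    ‖(1 - w) * Complex.exp (w + w ^ 2 / 2) - 1‖ ≤ 2 * ‖w‖ ^ 3 := by
  have hw1 : ‖-w‖ < 1 := by rw [norm_neg]; linarith
  have h1 := Complex.norm_log_sub_logTaylor_le 2 hw1
  have hT : Complex.logTaylor (2 + 1) (-w) = -(w + w ^ 2 / 2) := by
    simp [Complex.logTaylor_succ, Complex.logTaylor_zero]
    ring
  rw [hT, ← sub_eq_add_neg, norm_neg, sub_neg_eq_add] at h1
  set x := Complex.log (1 - w) + (w + w ^ 2 / 2) with hx
  have hne : 1 - w ≠ 0 := sub_ne_zero.2 fun h => by rw [← h] at hw; norm_num at hw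
  have hxe : (1 - w) * Complex.exp (w + w ^ 2 / 2) = Complex.exp x := by
    rw [hx, Complex.exp_add (Complex.log _), Complex.exp_log hne]
  have hinv : (1 - ‖w‖)⁻¹ ≤ 2 := by
    rw [inv_le_comm₀ (by linarith) two_pos]
    linarith
  have hx3 : ‖x‖ ≤ ‖w‖ ^ 3 := by
    refine h1.trans ?_
    rw [div_le_iff₀ (by positivity)]
    norm_num
    nlinarith [pow_nonneg (norm_nonneg w) 3]
  have hx1 : ‖x‖ ≤ 1 := hx3.trans (pow_le_one₀ (norm_nonneg _) (by linarith))
  rw [hxe]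
  exact (Complex.norm_exp_sub_one_le hx1).trans (by gcongr)

theorem norm_sigmaFactor_sub_one_le {r : ℝ} {l z : ℂ} (hz : ‖z‖ ≤ r) (hl : 2 * r ≤ ‖l‖) :
    ‖sigmaFactor l z - 1‖ ≤ 2 * r ^ 3 * ‖l‖ ^ (-3 : ℝ) := by
  rcases eq_or_ne l 0 with rfl | hl0
  · have : 0 ≤ r := (norm_nonneg z).trans hz
    rw [sigmaFactor_zero_left, sub_self, norm_zero]
    positivity
  have hlpos : 0 < ‖l‖ := norm_pos_iff.2 hl0
  have hw : ‖z / l‖ ≤ 1 / 2 := by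
    rw [norm_div, div_le_iff₀ hlpos]
    linarith
  have h1 := norm_one_sub_mul_exp_sub_one_le hw
  have h2 : z / l + (z / l) ^ 2 / 2 = z / l + z ^ 2 / (2 * l ^ 2) := by
    field_simp
  rw [h2] at h1
  refine h1.trans ?_
  rw [Real.rpow_neg (norm_nonneg l), norm_div, div_pow, ← div_eq_mul_inv, ← mul_div_assoc]
  norm_cast
  gcongr

theorem summable_norm_lattice (L : PeriodPair) :
    Summable fun l : L.lattice => ‖(l : ℂ)‖ ^ (-3 : ℝ) :=
  ZLattice.summable_norm_rpow _ _ (by simp; norm_num)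

theorem eventually_cofinite_le_norm (L : PeriodPair) (R : ℝ) :
    ∀ᶠ l : L.lattice in cofinite, R ≤ ‖(l : ℂ)‖ := by
  refine (isCompact_iff_finite.mp (isCompact_closedBall (0 : L.lattice) R)).subset fun l hl => ?_
  have : ‖(l : ℂ)‖ < R := by simpa using hl
  simpa using this.le

theorem hasProdLocallyUniformlyOn_sigmaFactor (L : PeriodPair) (r : ℝ) :
    HasProdLocallyUniformlyOn (fun (l : L.lattice) z => sigmaFactor l z) (sigmaProduct L)
      (Metric.ball 0 r) := by
  have h := Summable.hasProdLocallyUniformlyOn_one_add (K := Metric.ball (0 : ℂ) r)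
    (f := fun (l : L.lattice) z => sigmaFactor l z - 1) Metric.isOpen_ball
    ((summable_norm_lattice L).mul_left (2 * r ^ 3)) (by
      filter_upwards [eventually_cofinite_le_norm L (2 * r)] with l hl z hz
      exact norm_sigmaFactor_sub_one_le (by simpa using (mem_ball_zero_iff.1 hz).le) hl)
    fun l => ((differentiable_sigmaFactor l).continuous.sub continuous_const).continuousOn
  simp only [add_sub_cancel] at h
  exact h

theorem differentiable_sigmaProduct (L : PeriodPair) : Differentiable ℂ (sigmaProduct L) := by
  intro z
  have h : DifferentiableOn ℂ (sigmaProduct L) (Metric.ball 0 (‖z‖ + 1)) :=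
    (hasProdLocallyUniformlyOn_iff_tendstoLocallyUniformlyOn.1
      (hasProdLocallyUniformlyOn_sigmaFactor L _)).differentiableOn
      (.of_forall fun s => .fun_finsetProd fun l _ =>
        (differentiable_sigmaFactor l).differentiableOn) Metric.isOpen_ball
  exact h.differentiableAt (Metric.isOpen_ball.mem_nhds (by simp))

theorem differentiable_sigma (L : PeriodPair) : Differentiable ℂ (sigma L) :=
  differentiable_id.mul (differentiable_sigmaProduct L)

theorem sigmaProduct_zero (L : PeriodPair) : sigmaProduct L 0 = 1 := by simp [sigmaProduct]

theorem sigmaProduct_ne_zero (L : PeriodPair) {z : ℂ} (hz : z ∉ L.lattice) :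
    sigmaProduct L z ≠ 0 := by
  have h := tprod_one_add_ne_zero_of_summable (R := ℂ)
    (f := fun l : L.lattice => sigmaFactor l z - 1)
    (fun l => by
      rw [add_sub_cancel]
      exact sigmaFactor_ne_zero fun h => hz (h ▸ l.2)) (by
      refine Summable.of_norm_bounded_eventually
        ((summable_norm_lattice L).mul_left (2 * ‖z‖ ^ 3)) ?_
      filter_upwards [eventually_cofinite_le_norm L (2 * ‖z‖)] with l hl
      rw [norm_norm]
      exact norm_sigmaFactor_sub_one_le le_rfl hl)
  simp only [add_sub_cancel] at h
  exact h

theorem sigma_zero (L : PeriodPair) : sigma L 0 = 0 := by simp [sigma_eq]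

theorem sigma_ne_zero (L : PeriodPair) {z : ℂ} (hz : z ∉ L.lattice) : sigma L z ≠ 0 :=
  mul_ne_zero (by rintro rfl; exact hz (zero_mem _)) (sigmaProduct_ne_zero L hz)

theorem sigma_eq_zero (L : PeriodPair) {z : ℂ} (hz : z ∈ L.lattice) : sigma L z = 0 := by
  rcases eq_or_ne z 0 with rfl | h0
  · exact sigma_zero L
  · rw [sigma_eq, sigmaProduct, tprod_of_exists_eq_zero ⟨⟨z, hz⟩, ?_⟩, mul_zero]
    simp [sigmaFactor, h0]

theorem tendsto_sigma_div (L : PeriodPair) :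
    Tendsto (fun z => sigma L z / z) (𝓝[≠] 0) (𝓝 1) := by
  have h := ((differentiable_sigmaProduct L).continuous.tendsto 0).mono_left
    (nhdsWithin_le_nhds (s := {0}ᶜ))
  rw [sigmaProduct_zero] at h
  refine h.congr' ?_
  filter_upwards [self_mem_nhdsWithin] with z hz
  rw [sigma_eq, mul_div_cancel_left₀ _ hz]

/-- The series of `ζ(z) - 1 / z` converges locally uniformly. -/
theorem hasSumLocallyUniformly_zetaExcept (L : PeriodPair) :
    HasSumLocallyUniformly (fun (l : L.lattice) (z : ℂ) =>
      if (l : ℂ) = 0 then 0 else 1 / (z - l) + 1 / (l : ℂ) + z / (l : ℂ) ^ 2) (zetaExcept L) := by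
  refine L.hasSumLocallyUniformly_aux (u := fun r l => 2 * r ^ 2 * ‖(l : ℂ)‖ ^ (-3 : ℝ)) _
    (fun r _ => (summable_norm_lattice L).mul_left _) fun r hr =>
    Filter.eventually_atTop.mpr ⟨2 * r, ?_⟩
  rintro _ hR z hz l rfl
  have hlpos : 0 < ‖(l : ℂ)‖ := by linarith
  have hl0 : (l : ℂ) ≠ 0 := norm_pos_iff.1 hlpos
  have hzl : ‖(l : ℂ)‖ / 2 ≤ ‖z - l‖ := by
    rw [norm_sub_rev]
    exact le_trans (by linarith) (norm_sub_norm_le _ _)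
  have hzl0 : z - l ≠ 0 := norm_pos_iff.1 (by linarith)
  rw [if_neg hl0]
  have h1 : 1 / (z - l) + 1 / (l : ℂ) + z / (l : ℂ) ^ 2 = z ^ 2 / ((z - l) * (l : ℂ) ^ 2) := by
    field_simp
    ring
  rw [h1, norm_div, norm_mul, norm_pow, norm_pow, Real.rpow_neg hlpos.le]
  calc ‖z‖ ^ 2 / (‖z - l‖ * ‖(l : ℂ)‖ ^ 2)
      ≤ r ^ 2 / (‖(l : ℂ)‖ / 2 * ‖(l : ℂ)‖ ^ 2) := by gcongr
    _ = 2 * r ^ 2 * (‖(l : ℂ)‖ ^ 3)⁻¹ := by field_simp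
    _ = _ := by norm_cast

theorem differentiableOn_zetaExcept_summand (L : PeriodPair) (l : L.lattice) :
    DifferentiableOn ℂ (fun z : ℂ =>
      if (l : ℂ) = 0 then 0 else 1 / (z - l) + 1 / (l : ℂ) + z / (l : ℂ) ^ 2)
      (L.lattice : Set ℂ)ᶜ := by
  intro z hz
  have : z - l ≠ 0 := sub_ne_zero.2 fun h => hz (h ▸ l.2)
  split_ifs
  · exact differentiableWithinAt_const _
  · exact DifferentiableAt.differentiableWithinAt (by fun_prop (disch := exact this))

theorem hasDerivAt_zetaExcept (L : PeriodPair) {z : ℂ} (hz : z ∉ L.lattice) :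
    HasDerivAt (zetaExcept L) (-L.weierstrassPExcept 0 z) z := by
  have hlu := (hasSumLocallyUniformly_zetaExcept L).tendstoLocallyUniformlyOn
    (s := (L.lattice : Set ℂ)ᶜ)
  have hdiff : ∀ s : Finset L.lattice, DifferentiableOn ℂ (fun z : ℂ => ∑ l ∈ s,
      if (l : ℂ) = 0 then 0 else 1 / (z - l) + 1 / (l : ℂ) + z / (l : ℂ) ^ 2)
      (L.lattice : Set ℂ)ᶜ := fun s => .fun_sum fun l _ => differentiableOn_zetaExcept_summand L l
  have hopen : IsOpen (L.lattice : Set ℂ)ᶜ := L.isClosed_lattice.isOpen_compl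
  have hd := (hlu.differentiableOn (.of_forall hdiff) hopen).differentiableAt
    (hopen.mem_nhds hz)
  have ht := (hlu.deriv (.of_forall hdiff) hopen).tendsto_at hz
  have hs := (L.hasSum_weierstrassPExcept 0 z).neg
  have : deriv (zetaExcept L) z = -L.weierstrassPExcept 0 z := by
    refine tendsto_nhds_unique ht (hs.congr' ?_)
    refine .of_forall fun s => ?_
    simp only [Function.comp]
    rw [deriv_fun_sum fun l _ => (differentiableOn_zetaExcept_summand L l).differentiableAt
      (hopen.mem_nhds hz)]
    refine Finset.sum_congr rfl fun l _ => ?_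
    have hzl : z - l ≠ 0 := sub_ne_zero.2 fun h => hz (h ▸ l.2)
    split_ifs with hl
    · simp
    · have h1 : HasDerivAt (fun z : ℂ => 1 / (z - l) + 1 / (l : ℂ) + z / (l : ℂ) ^ 2)
          (-1 / (z - l) ^ 2 + 1 / (l : ℂ) ^ 2) z := by
        simp only [one_div]
        have := (((hasDerivAt_id z).sub_const (l : ℂ)).inv hzl).add_const ((l : ℂ)⁻¹) |>.fun_add
          ((hasDerivAt_id z).div_const ((l : ℂ) ^ 2))
        simpa using this
      rw [h1.deriv]
      ring
  rw [← this]
  exact hd.hasDerivAt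

theorem logDeriv_sigmaFactor {l z : ℂ} (h : z ≠ l) :
    logDeriv (sigmaFactor l) z =
      if l = 0 then 0 else 1 / (z - l) + 1 / l + z / l ^ 2 := by
  split_ifs with hl
  · subst hl
    have : sigmaFactor 0 = fun _ => 1 := funext sigmaFactor_zero_left
    rw [this, logDeriv_const]
    rfl
  · have hzl : z - l ≠ 0 := sub_ne_zero.2 h
    have hlz : l - z ≠ 0 := sub_ne_zero.2 h.symm
    have h1 : 1 - z / l ≠ 0 := by
      rw [one_sub_div hl]
      exact div_ne_zero hlz hl
    have hd : HasDerivAt (sigmaFactor l)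
        ((-(1 / l)) * Complex.exp (z / l + z ^ 2 / (2 * l ^ 2)) +
          (1 - z / l) * (Complex.exp (z / l + z ^ 2 / (2 * l ^ 2)) *
            (1 / l + (2 * z) / (2 * l ^ 2)))) z := by
      have h2 : HasDerivAt (fun z : ℂ => z / l + z ^ 2 / (2 * l ^ 2))
          (1 / l + (2 * z) / (2 * l ^ 2)) z := by
        simpa using ((hasDerivAt_id z).div_const l).fun_add
          (((hasDerivAt_id z).pow 2).div_const (2 * l ^ 2))
      exact (((hasDerivAt_id z).div_const l).const_sub 1).mul h2.cexp
    rw [logDeriv_apply, hd.deriv, sigmaFactor]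
    have he := Complex.exp_ne_zero (z / l + z ^ 2 / (2 * l ^ 2))
    rw [div_eq_iff (mul_ne_zero h1 he)]
    field_simp
    ring

theorem logDeriv_sigma (L : PeriodPair) {z : ℂ} (hz : z ∉ L.lattice) :
    logDeriv (sigma L) z = 1 / z + zetaExcept L z := by
  have hz0 : z ≠ 0 := by rintro rfl; exact hz (zero_mem _)
  have hne : ∀ l : L.lattice, z ≠ l := fun l h => hz (h ▸ l.2)
  have h1 : sigma L = fun z => z * sigmaProduct L z := rfl
  rw [h1, logDeriv_mul z hz0 (sigmaProduct_ne_zero L hz) differentiableAt_fun_id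
    (differentiable_sigmaProduct L z), logDeriv_id']
  congr 1
  have hball : z ∈ Metric.ball (0 : ℂ) (‖z‖ + 1) := by simp
  have hS := (hasSumLocallyUniformly_zetaExcept L).hasSum (x := z)
  have := logDeriv_tprod_eq_tsum (f := fun (l : L.lattice) z => sigmaFactor l z)
    Metric.isOpen_ball hball
    (fun l => sigmaFactor_ne_zero (hne l))
    (fun l => (differentiable_sigmaFactor l).differentiableOn)
    (by simpa only [fun l => logDeriv_sigmaFactor (hne l)] using hS.summable)
    ⟨_, hasProdLocallyUniformlyOn_sigmaFactor L _⟩ (sigmaProduct_ne_zero L hz)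
  simpa only [fun l => logDeriv_sigmaFactor (hne l)] using! this

theorem add_mem_lattice_iff (L : PeriodPair) {ω : ℂ} (hω : ω ∈ L.lattice) {z : ℂ} :
    z + ω ∈ L.lattice ↔ z ∈ L.lattice := Submodule.add_mem_iff_left _ hω

theorem countable_lattice (L : PeriodPair) : (L.lattice : Set ℂ).Countable := by
  have : Countable L.lattice := L.latticeEquivProd.toEquiv.countable_iff.2 inferInstance
  exact Set.to_countable _

/-- The logarithmic derivative of the sigma function has constant increments along the lattice,
since its derivative `-℘` is periodic. -/
theorem exists_logDeriv_sigma_add (L : PeriodPair) {ω : ℂ} (hω : ω ∈ L.lattice) :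
    ∃ B, ∀ z ∉ L.lattice, logDeriv (sigma L) (z + ω) = logDeriv (sigma L) z + B := by
  have hopen : IsOpen (L.lattice : Set ℂ)ᶜ := L.isClosed_lattice.isOpen_compl
  have hderiv : ∀ z ∉ L.lattice,
      HasDerivAt (fun z => 1 / z + zetaExcept L z) (-L.weierstrassP z) z := by
    intro z hz
    have hz0 : z ≠ 0 := by rintro rfl; exact hz (zero_mem _)
    simp only [one_div]
    refine ((hasDerivAt_inv hz0).fun_add (hasDerivAt_zetaExcept L hz)).congr_deriv ?_
    have := L.weierstrassPExcept_add 0 z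
    simp only [Submodule.coe_zero, sub_zero, ne_eq, OfNat.ofNat_ne_zero, not_false_eq_true,
      zero_pow, div_zero, one_div] at this
    rw [← this]
    ring
  have hinc : ∀ z ∉ L.lattice, HasDerivAt
      (fun z => (1 / (z + ω) + zetaExcept L (z + ω)) - (1 / z + zetaExcept L z)) 0 z := by
    intro z hz
    have h1 := (hderiv _ ((add_mem_lattice_iff L hω).not.2 hz)).comp_add_const z ω
    refine (h1.fun_sub (hderiv z hz)).congr_deriv ?_
    rw [L.weierstrassP_add_coe z ⟨ω, hω⟩, sub_self]
  obtain ⟨B, hB⟩ := hopen.exists_is_const_of_deriv_eq_zero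
    (isPreconnected_compl_of_countable (countable_lattice L))
    (fun z hz => (hinc z hz).differentiableAt.differentiableWithinAt)
    (fun z hz => (hinc z hz).deriv)
  refine ⟨B, fun z hz => ?_⟩
  rw [logDeriv_sigma L hz, logDeriv_sigma L ((add_mem_lattice_iff L hω).not.2 hz), ← hB z hz]
  ring

/-- Quasi-periodicity of the sigma function. -/
theorem exists_sigma_add (L : PeriodPair) {ω : ℂ} (hω : ω ∈ L.lattice) :
    ∃ A B : ℂ, A ≠ 0 ∧ ∀ z, sigma L (z + ω) = A * Complex.exp (B * z) * sigma L z := by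
  obtain ⟨B, hB⟩ := exists_logDeriv_sigma_add L hω
  have hopen : IsOpen (L.lattice : Set ℂ)ᶜ := L.isClosed_lattice.isOpen_compl
  have hω' : ∀ {z}, z ∉ L.lattice → z + ω ∉ L.lattice := (add_mem_lattice_iff L hω).not.2
  have hd1 : Differentiable ℂ fun z => sigma L (z + ω) :=
    (differentiable_sigma L).comp (by fun_prop)
  have he : Differentiable ℂ fun z => Complex.exp (B * z) := by fun_prop
  have hd2 : Differentiable ℂ fun z => Complex.exp (B * z) * sigma L z :=
    he.mul (differentiable_sigma L)
  obtain ⟨A, hA0, hA⟩ := (logDeriv_eqOn_iff hd1.differentiableOn hd2.differentiableOn hopen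
    (isPreconnected_compl_of_countable (countable_lattice L))
    (fun z hz => mul_ne_zero (Complex.exp_ne_zero _) (sigma_ne_zero L hz))
    (fun z hz => sigma_ne_zero L (hω' hz))).1 (fun z hz => by
      have h1 : logDeriv (fun z => Complex.exp (B * z)) z = B := by
        have h2 : HasDerivAt (fun z => B * z) B z := by
          simpa using (hasDerivAt_id z).const_mul B
        rw [logDeriv_apply, h2.cexp.deriv, mul_div_cancel_left₀ _ (Complex.exp_ne_zero _)]
      rw [logDeriv_mul (f := fun z => Complex.exp (B * z)) z (Complex.exp_ne_zero _)
        (sigma_ne_zero L hz) (he z)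
        (differentiable_sigma L z), h1, add_comm B, ← hB z hz, logDeriv_apply, logDeriv_apply,
        deriv_comp_add_const])
  refine ⟨A, B, hA0, fun z => ?_⟩
  by_cases hz : z ∈ L.lattice
  · rw [sigma_eq_zero L hz, sigma_eq_zero L ((add_mem_lattice_iff L hω).2 hz), mul_zero]
  · rw [mul_assoc]
    exact hA hz

/-! ### Nondegenerate Krichever genera -/

theorem tendsto_mul_one_div_of_tendsto_div {f : ℂ → ℂ}
    (hf : Tendsto (fun z => f z / z) (𝓝[≠] 0) (𝓝 1)) :
    Tendsto (fun z => z * (1 / f z)) (𝓝[≠] 0) (𝓝 1) := by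
  have h := hf.inv₀ one_ne_zero
  rw [inv_one] at h
  refine h.congr fun z => ?_
  rw [inv_div, mul_one_div]

theorem tendsto_norm_atTop_of_tendsto_mul {h : ℂ → ℂ}
    (hh : Tendsto (fun z => z * h z) (𝓝[≠] 0) (𝓝 1)) :
    Tendsto (fun z => ‖h z‖) (𝓝[≠] 0) atTop := by
  have h1 : Tendsto (fun z : ℂ => ‖z⁻¹‖) (𝓝[≠] 0) atTop :=
    tendsto_norm_cobounded_atTop.comp tendsto_inv₀_nhdsNE_zero
  have h2 := hh.norm
  rw [norm_one] at h2
  refine (h1.atTop_mul_pos one_pos h2).congr' ?_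
  filter_upwards [self_mem_nhdsWithin] with z hz
  rw [← norm_mul, inv_mul_cancel_left₀ hz]

theorem solvesHirzebruchEquation_iff {n : ℕ} {f : ℂ → ℂ} :
    SolvesHirzebruchEquation n f ↔ ∃ C : ℂ, ∀ᶠ u : Fin (n + 1) → ℂ in 𝓝 0,
      Function.Injective u → hirzebruchSum (fun t => 1 / f t) u = C := Iff.rfl

theorem kricheverFun_eq (L : PeriodPair) (α s : ℂ) :
    kricheverFun L α s = fun t =>
      Complex.exp ((α - zeta L s) * t) * sigma L s * sigma L t / sigma L (s - t) := by
  funext t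
  rw [kricheverFun, bakerAkhiezer, sub_mul, Complex.exp_sub]
  have := Complex.exp_ne_zero (zeta L s * t)
  rw [div_mul_eq_mul_div, div_div_eq_mul_div, div_mul_eq_mul_div, div_mul_eq_mul_div, div_div,
    mul_comm (sigma L (s - t)), mul_assoc]

theorem exists_kricheverFun_add (L : PeriodPair) (α s : ℂ) {ω : ℂ} (hω : ω ∈ L.lattice) :
    ∃ χ : ℂ, χ ≠ 0 ∧ ∀ z, kricheverFun L α s (z + ω) = χ * kricheverFun L α s z := by
  obtain ⟨A, B, hA, hσ⟩ := exists_sigma_add L hω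
  set β := α - zeta L s with hβ
  refine ⟨Complex.exp (β * ω) * A * (A * Complex.exp (B * (s - ω))),
    by simp [hA, Complex.exp_ne_zero], fun z => ?_⟩
  have h1 : sigma L (s - z) = A * Complex.exp (B * (s - (z + ω))) * sigma L (s - (z + ω)) := by
    rw [← hσ]
    congr 1
    ring
  have h2 : Complex.exp (B * z) * Complex.exp (B * (s - (z + ω))) = Complex.exp (B * (s - ω)) := by
    rw [← Complex.exp_add]
    congr 1
    ring
  simp only [kricheverFun_eq, ← hβ]
  rw [hσ, h1, mul_add, Complex.exp_add, ← h2]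
  have he := Complex.exp_ne_zero (B * (s - (z + ω)))
  by_cases h0 : sigma L (s - (z + ω)) = 0
  · simp [h0]
  · field_simp

theorem tendsto_kricheverFun_div (L : PeriodPair) (α : ℂ) {s : ℂ} (hs : s ∉ L.lattice) :
    Tendsto (fun z => kricheverFun L α s z / z) (𝓝[≠] 0) (𝓝 1) := by
  have hc : ContinuousAt (fun t => Complex.exp ((α - zeta L s) * t) * sigma L s /
      sigma L (s - t)) 0 := by
    have := (differentiable_sigma L).continuous
    exact ContinuousAt.div (by fun_prop) (by fun_prop) (by simpa using sigma_ne_zero L hs)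
  have h := (hc.tendsto.mono_left (nhdsWithin_le_nhds (s := {0}ᶜ))).mul (tendsto_sigma_div L)
  simp only [mul_zero, Complex.exp_zero, one_mul, sub_zero,
    div_self (sigma_ne_zero L hs)] at h
  refine h.congr fun z => ?_
  rw [kricheverFun_eq]
  ring

theorem meromorphicOrderAt_sigma_of_notMem (L : PeriodPair) {z : ℂ} (hz : z ∉ L.lattice) :
    meromorphicOrderAt (sigma L) z = 0 := by
  have ha := (differentiable_sigma L).analyticAt z
  rw [ha.meromorphicOrderAt_eq, ha.analyticOrderAt_eq_zero.2 (sigma_ne_zero L hz)]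
  rfl

theorem meromorphicOrderAt_sigma_of_mem (L : PeriodPair) {l : ℂ} (hl : l ∈ L.lattice) :
    meromorphicOrderAt (sigma L) l = 1 := by
  obtain ⟨A, B, hA, hσ⟩ := exists_sigma_add L hl
  have ha := (differentiable_sigma L).analyticAt l
  refine (meromorphicOrderAt_eq_int_iff (n := 1) ha.meromorphicAt).2
    ⟨fun z => A * Complex.exp (B * (z - l)) * sigmaProduct L (z - l), ?_, ?_, ?_⟩
  · have := differentiable_sigmaProduct L
    exact Differentiable.analyticAt (by fun_prop) _
  · simp [hA, sigmaProduct_zero]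
  · refine .of_forall fun z => ?_
    have := hσ (z - l)
    rw [sub_add_cancel, sigma_eq L (z - l)] at this
    rw [this, zpow_one, smul_eq_mul]
    ring

theorem meromorphicOrderAt_sigma_sub (L : PeriodPair) (s z : ℂ) :
    meromorphicOrderAt (fun t => sigma L (s - t)) z = meromorphicOrderAt (sigma L) (s - z) := by
  refine meromorphicOrderAt_comp_of_deriv_ne_zero (f := sigma L) (g := fun t => s - t)
    (by fun_prop) ?_
  rw [deriv_const_sub]
  simp

theorem meromorphicOrderAt_kricheverFun (L : PeriodPair) (α : ℂ) {s : ℂ} (hs : s ∉ L.lattice)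
    (z : ℂ) : MeromorphicAt (kricheverFun L α s) z ∧
      meromorphicOrderAt (kricheverFun L α s) z =
        meromorphicOrderAt (sigma L) z - meromorphicOrderAt (sigma L) (s - z) := by
  have hd := differentiable_sigma L
  have h1 : AnalyticAt ℂ (sigma L) z := hd.analyticAt z
  have h2 : AnalyticAt ℂ (fun t => sigma L (s - t)) z :=
    Differentiable.analyticAt (by fun_prop) z
  have h3 : AnalyticAt ℂ (fun t => Complex.exp ((α - zeta L s) * t) * sigma L s) z :=
    Differentiable.analyticAt (by fun_prop) z
  rw [kricheverFun_eq]
  refine ⟨(h3.mul h1).meromorphicAt.div h2.meromorphicAt, ?_⟩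
  rw [fun_meromorphicOrderAt_div (h3.fun_mul h1).meromorphicAt h2.meromorphicAt,
    meromorphicOrderAt_sigma_sub]
  congr 1
  exact meromorphicOrderAt_mul_of_ne_zero h3
    (mul_ne_zero (Complex.exp_ne_zero _) (sigma_ne_zero L hs))

theorem differentiableAt_one_div_kricheverFun (L : PeriodPair) (α : ℂ) {s : ℂ}
    (hs : s ∉ L.lattice) {z : ℂ} (hz : z ∉ L.lattice) :
    DifferentiableAt ℂ (fun t => 1 / kricheverFun L α s t) z := by
  have hd := differentiable_sigma L
  simp only [kricheverFun_eq, one_div_div]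
  refine DifferentiableAt.div (by fun_prop) (by fun_prop) ?_
  exact mul_ne_zero (mul_ne_zero (Complex.exp_ne_zero _) (sigma_ne_zero L hs))
    (sigma_ne_zero L hz)

/-- The function of a nondegenerate Krichever genus that solves the functional equation is an
elliptic function of level `n + 1`. -/
theorem isEllipticOfLevel_of_solvesHirzebruchEquation {n : ℕ} (hn : 1 ≤ n) (L : PeriodPair)
    (α : ℂ) {s : ℂ} (hs : s ∉ L.lattice)
    (h : SolvesHirzebruchEquation n (kricheverFun L α s)) :
    IsEllipticOfLevel (n + 1) (kricheverFun L α s) := by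
  obtain ⟨C, hC⟩ := solvesHirzebruchEquation_iff.1 h
  set f := kricheverFun L α s
  have hlim := tendsto_kricheverFun_div L α hs
  have hper : ∀ l ∈ L.lattice, ∀ z, f (z + l) ^ (n + 1) = f z ^ (n + 1) := by
    intro l hl z
    obtain ⟨χ, hχ0, hχ⟩ := exists_kricheverFun_add L α s hl
    have := multiplier_pow_eq_one (Λ := L.lattice.toAddSubgroup) L.isClosed_lattice
      (countable_lattice L) (fun z hz => differentiableAt_one_div_kricheverFun L α hs hz)
      (tendsto_norm_atTop_of_tendsto_mul (tendsto_mul_one_div_of_tendsto_div hlim)) hn hC hl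
      (inv_ne_zero hχ0) (fun z => by rw [hχ, ← one_div_mul_one_div, one_div χ])
    rw [inv_pow, inv_eq_one] at this
    have hz : f (z + l) = χ * f z := hχ z
    rw [hz, mul_pow, this, one_mul]
  have hmer : Meromorphic f := fun z => (meromorphicOrderAt_kricheverFun L α hs z).1
  have hord : ∀ z, meromorphicOrderAt (fun z => f z ^ (n + 1)) z = (n + 1 : ℕ) *
      (meromorphicOrderAt (sigma L) z - meromorphicOrderAt (sigma L) (s - z)) := fun z => by
    rw [fun_meromorphicOrderAt_pow (hmer z), (meromorphicOrderAt_kricheverFun L α hs z).2]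
  refine ⟨by omega, L, s, fun z => f z ^ (n + 1), ?_, hmer, EventuallyEq.rfl, hlim⟩
  refine ⟨fun z => (hmer z).fun_pow _, fun l hl => .of_forall (hper l hl), hs, ?_, ?_, ?_, ?_⟩
  · intro z hz
    rw [hord, meromorphicOrderAt_sigma_of_mem L hz, meromorphicOrderAt_sigma_of_notMem L
      fun h => hs ((Submodule.sub_mem_iff_left _ hz).1 h)]
    simp
  · intro z hz
    have hz' : s - z ∈ L.lattice := by simpa using neg_mem hz
    rw [hord, meromorphicOrderAt_sigma_of_mem L hz', meromorphicOrderAt_sigma_of_notMem L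
      fun h => hs ((Submodule.sub_mem_iff_left _ h).1 hz')]
    rw [show (0 - 1 : WithTop ℤ) = ((-1 : ℤ) : WithTop ℤ) from rfl,
      show ((n + 1 : ℕ) : WithTop ℤ) = (((n + 1 : ℕ) : ℤ) : WithTop ℤ) from rfl,
      ← WithTop.coe_mul, mul_neg_one]
  · intro z hz hzs
    rw [hord, meromorphicOrderAt_sigma_of_notMem L hz, meromorphicOrderAt_sigma_of_notMem L
      fun h => hzs (by simpa using neg_mem h)]
    simp
  · simpa [div_pow] using hlim.pow (n + 1)

/-! ### Elliptic functions of level `d` -/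

theorem eventually_nhdsNE_notMem_lattice (L : PeriodPair) (c : ℂ) :
    ∀ᶠ z in 𝓝[≠] c, z ∉ L.lattice := by
  filter_upwards [nhdsWithin_le_nhds (L.compl_lattice_sdiff_singleton_mem_nhds c),
    self_mem_nhdsWithin] with z hz hzc hzL
  exact hz ⟨hzL, hzc⟩

theorem tendsto_add_const_nhdsNE (c a : ℂ) : Tendsto (fun z => z + a) (𝓝[≠] c) (𝓝[≠] (c + a)) := by
  refine tendsto_nhdsWithin_iff.2 ⟨?_, ?_⟩
  · exact (Continuous.tendsto (by fun_prop) _).mono_left nhdsWithin_le_nhds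
  · filter_upwards [self_mem_nhdsWithin] with z hz
    simpa using hz

theorem exists_isCompact_forall_add_mem (L : PeriodPair) :
    ∃ K : Set ℂ, IsCompact K ∧ ∀ z, ∃ l ∈ L.lattice, z + l ∈ K := by
  refine ⟨closure (ZSpan.fundamentalDomain L.basis),
    (ZSpan.fundamentalDomain_isBounded L.basis).isCompact_closure, fun z => ?_⟩
  refine ⟨-(ZSpan.floor L.basis z : ℂ), neg_mem ?_, subset_closure ?_⟩
  · rw [L.lattice_eq_span_range_basis]
    exact (ZSpan.floor L.basis z).2
  · rw [← sub_eq_add_neg]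
    exact ZSpan.fract_mem_fundamentalDomain L.basis z

theorem eventuallyEq_nhdsNE_of_codiscrete {f g : ℂ → ℂ} (h : f =ᶠ[codiscrete ℂ] g) (z : ℂ) :
    f =ᶠ[𝓝[≠] z] g := by
  have h1 := mem_codiscreteWithin_iff_forall_mem_nhdsNE.1 h z (Set.mem_univ z)
  rw [Set.compl_univ, Set.union_empty] at h1
  exact h1

theorem eq_of_eventuallyEq_nhdsNE {f g : ℂ → ℂ} {z : ℂ} (hf : ContinuousAt f z)
    (hg : ContinuousAt g z) (h : f =ᶠ[𝓝[≠] z] g) : f z = g z :=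
  ((hf.eventuallyEq_nhds_iff_eventuallyEq_nhdsNE hg).1 h).eq_of_nhds

/-- A continuous choice of `d`-th roots of unity on a preconnected open set is constant, since its
derivative vanishes. -/
theorem exists_eq_const_of_pow_eq_one {r : ℂ → ℂ} {U : Set ℂ} (hU : IsOpen U)
    (hUc : IsPreconnected U) (hr : DifferentiableOn ℂ r U) {d : ℕ} (hd : d ≠ 0)
    (h1 : ∀ z ∈ U, r z ^ d = 1) : ∃ c, ∀ z ∈ U, r z = c := by
  refine hU.exists_is_const_of_deriv_eq_zero hUc hr fun z hz => ?_
  have h2 := ((hr.differentiableAt (hU.mem_nhds hz)).hasDerivAt.fun_pow d)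
  have h3 : HasDerivAt (fun w => r w ^ d) 0 z := by
    refine (hasDerivAt_const z (1 : ℂ)).congr_of_eventuallyEq ?_
    filter_upwards [hU.mem_nhds hz] with w hw using h1 w hw
  have h4 := h2.unique h3
  have hr0 : r z ≠ 0 := fun h0 => by
    have := h1 z hz
    rw [h0, zero_pow hd] at this
    exact zero_ne_one this
  simpa [hd, hr0] using h4

/-- The order of an elliptic function of level `d` is the `d`-th part of that of its power. -/
theorem meromorphicOrderAt_eq_of_pow {f g : ℂ → ℂ} {z : ℂ} (hf : MeromorphicAt f z) {d : ℕ}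
    (hd : d ≠ 0) (hfg : (fun z => f z ^ d) =ᶠ[𝓝[≠] z] g) {m : ℤ}
    (hg : meromorphicOrderAt g z = ((d * m : ℤ) : WithTop ℤ)) : meromorphicOrderAt f z = m := by
  rw [← meromorphicOrderAt_congr hfg, fun_meromorphicOrderAt_pow hf] at hg
  cases h : meromorphicOrderAt f z with
  | top =>
    rw [h, WithTop.mul_top (by exact_mod_cast hd)] at hg
    exact absurd hg (WithTop.coe_ne_top).symm
  | coe a =>
    rw [h] at hg
    have : (d : ℤ) * a = d * m := by exact_mod_cast hg
    rw [mul_left_cancel₀ (by exact_mod_cast hd) this]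

/-- An elliptic function of a level dividing `n + 1` solves the functional equation: its inverse has
simple poles at the lattice points only, and its multipliers are `d`-th roots of unity. -/
theorem IsEllipticOfLevel.solvesHirzebruchEquation {n d : ℕ} (hdn : d ∣ n + 1) {f : ℂ → ℂ}
    (hf : IsEllipticOfLevel d f) : SolvesHirzebruchEquation n f := by
  obtain ⟨hd1, L, P, g, hg, hmer, hfg, hlim⟩ := hf
  have hd0 : d ≠ 0 := by omega
  have hfg' := eventuallyEq_nhdsNE_of_codiscrete hfg
  have hinv : MeromorphicOn f⁻¹ Set.univ := fun z _ => (hmer z).inv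
  set h : ℂ → ℂ := toMeromorphicNFOn f⁻¹ Set.univ
  have hhf : ∀ z, h =ᶠ[𝓝[≠] z] f⁻¹ := fun z =>
    hinv.toMeromorphicNFOn_eq_self_on_nhdsNE (Set.mem_univ z)
  have hNF : ∀ z, MeromorphicNFAt h z := fun z =>
    meromorphicNFOn_toMeromorphicNFOn f⁻¹ Set.univ (Set.mem_univ z)
  have hord : ∀ z, meromorphicOrderAt h z = -meromorphicOrderAt f z := fun z => by
    rw [meromorphicOrderAt_congr (hhf z), meromorphicOrderAt_inv]
  have hord0 : ∀ z, z ∉ L.lattice → z - P ∉ L.lattice → meromorphicOrderAt h z = 0 := by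
    intro z hz hzP
    rw [hord, meromorphicOrderAt_eq_of_pow (m := 0) (hmer z) hd0 (hfg' z) (by
      rw [hg.order_other z hz hzP]; simp)]
    simp
  have han : ∀ z, z ∉ L.lattice → AnalyticAt ℂ h z := by
    intro z hz
    refine (hNF z).meromorphicOrderAt_nonneg_iff_analyticAt.1 ?_
    by_cases hzP : z - P ∈ L.lattice
    · rw [hord, meromorphicOrderAt_eq_of_pow (m := -1) (hmer z) hd0 (hfg' z) (by
        rw [hg.order_pole z hzP]; simp)]
      exact WithTop.coe_le_coe.2 (by norm_num)
    · rw [hord0 z hz hzP]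
  have hne : ∀ z, z ∉ L.lattice → z - P ∉ L.lattice → h z ≠ 0 := fun z hz hzP =>
    (hNF z).meromorphicOrderAt_eq_zero_iff.1 (hord0 z hz hzP)
  set U : Set ℂ := {z | z ∉ L.lattice ∧ z - P ∉ L.lattice}
  have hUcompl : U = ((L.lattice : Set ℂ) ∪ (fun z => z - P) ⁻¹' (L.lattice : Set ℂ))ᶜ := by
    ext z
    simp [U]
  have hUcount : ((L.lattice : Set ℂ) ∪ (fun z => z - P) ⁻¹' (L.lattice : Set ℂ)).Countable :=
    (countable_lattice L).union ((countable_lattice L).preimage sub_left_injective)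
  have hUo : IsOpen U := by
    rw [hUcompl]
    exact (L.isClosed_lattice.union (L.isClosed_lattice.preimage (by fun_prop))).isOpen_compl
  have hUc : IsPreconnected U := hUcompl ▸ isPreconnected_compl_of_countable hUcount
  have hUne : U.Nonempty := by
    rw [hUcompl]
    exact (hUcount.dense_compl ℝ).nonempty
  have hUev : ∀ z, ∀ᶠ w in 𝓝[≠] z, w ∈ U := by
    intro z
    have := (tendsto_add_const_nhdsNE z (-P)).eventually (eventually_nhdsNE_notMem_lattice L _)
    filter_upwards [eventually_nhdsNE_notMem_lattice L z, this] with w h1 h2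
    exact ⟨h1, by rwa [sub_eq_add_neg]⟩
  have hadd : ∀ ω ∈ L.lattice, ∀ z, AnalyticAt ℂ h (z + ω) →
      AnalyticAt ℂ (fun z => h (z + ω)) z := fun ω _ z hz =>
    AnalyticAt.comp (f := fun z => z + ω) hz (by fun_prop)
  have hpow : ∀ ω ∈ L.lattice, ∀ z, z ∉ L.lattice → h (z + ω) ^ d = h z ^ d := by
    intro ω hω z hz
    have hz' := (add_mem_lattice_iff L hω).not.2 hz
    refine eq_of_eventuallyEq_nhdsNE (f := fun z => h (z + ω) ^ d) (g := fun z => h z ^ d)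
      ((hadd ω hω z (han _ hz')).continuousAt.pow d) ((han z hz).continuousAt.pow d) ?_
    have hT := tendsto_add_const_nhdsNE z ω
    filter_upwards [hhf z, hT.eventually (hhf _), hfg' z, hT.eventually (hfg' _),
      eventuallyEq_nhdsNE_of_codiscrete (hg.periodic ω hω) z] with w h1 h2 h3 h4 h5
    rw [h1, h2, Pi.inv_apply, Pi.inv_apply, inv_pow, inv_pow, h3, h4, h5]
  have hper : ∀ ω ∈ L.lattice, ∃ χ : ℂ, χ ^ (n + 1) = 1 ∧
      ∀ z ∉ L.lattice, h (z + ω) = χ * h z := by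
    intro ω hω
    have hω' : ∀ {z}, z ∉ L.lattice → z + ω ∉ L.lattice := (add_mem_lattice_iff L hω).not.2
    obtain ⟨χ, hχ⟩ := exists_eq_const_of_pow_eq_one (r := fun z => h (z + ω) / h z) hUo hUc
      (fun z hz => ((hadd ω hω z (han _ (hω' hz.1))).differentiableAt.div
        (han z hz.1).differentiableAt (hne z hz.1 hz.2)).differentiableWithinAt) hd0
      (fun z hz => by
        rw [div_pow, hpow ω hω z hz.1, div_self (pow_ne_zero _ (hne z hz.1 hz.2))])
    refine ⟨χ, ?_, fun z hz => ?_⟩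
    · obtain ⟨z, hz⟩ := hUne
      obtain ⟨m, hm⟩ := hdn
      rw [← hχ z hz, hm, pow_mul, div_pow, hpow ω hω z hz.1,
        div_self (pow_ne_zero _ (hne z hz.1 hz.2)), one_pow]
    · refine eq_of_eventuallyEq_nhdsNE (f := fun z => h (z + ω)) (g := fun z => χ * h z)
        (hadd ω hω z (han _ (hω' hz))).continuousAt
        (continuousAt_const.mul (han z hz).continuousAt) ?_
      filter_upwards [hUev z] with w hw
      rw [← hχ w hw, div_mul_cancel₀ _ (hne w hw.1 hw.2)]
  have hres : Tendsto (fun z => z * h z) (𝓝[≠] 0) (𝓝 1) := by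
    refine (tendsto_mul_one_div_of_tendsto_div hlim).congr' ?_
    filter_upwards [hhf 0] with z hz
    rw [hz, Pi.inv_apply, one_div]
  obtain ⟨K, hK, hKL⟩ := exists_isCompact_forall_add_mem L
  obtain ⟨C, hC⟩ := exists_eventually_hirzebruchSum_eq_of_multiplier
    (Λ := L.lattice.toAddSubgroup) (eventually_nhdsNE_notMem_lattice L) (countable_lattice L) hK
    hKL (fun z hz => (han z hz).differentiableAt) hres hper
  refine solvesHirzebruchEquation_iff.2 ⟨C, ?_⟩
  -- near the origin, `h` agrees with `1 / f` except at the origin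
  have hsub : ∀ᶠ u : Fin (n + 1) → ℂ in 𝓝 0, ∀ i k, u i - u k ≠ 0 →
      h (u i - u k) = 1 / f (u i - u k) := by
    refine eventually_all.2 fun i => eventually_all.2 fun k => ?_
    have hc : Tendsto (fun u : Fin (n + 1) → ℂ => u i - u k) (𝓝 0) (𝓝 0) := by
      have : Continuous fun u : Fin (n + 1) → ℂ => u i - u k := by fun_prop
      simpa using this.tendsto 0
    filter_upwards [hc.eventually (eventually_nhdsWithin_iff.1 (hhf 0))] with u hu hne
    rw [hu hne, Pi.inv_apply, one_div]
  filter_upwards [hC, hsub] with u hu hus hui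
  rw [← hu hui]
  refine Finset.sum_congr rfl fun k _ => Finset.prod_congr rfl fun i hi => ?_
  exact (hus i k (sub_ne_zero.2 (hui.ne (Finset.ne_of_mem_erase hi)))).symm

/-! ### Todd genera and degenerate elliptic functions of level `d` -/

/-- Lagrange interpolation of `∏ i, (A x i + B X)` at the nodes `0` and `x k`: the Hirzebruch sum of
the Todd genus in the variables `x i = exp ((α - β) u i)`. -/
theorem add_mul_sum_prod_div_sub {n : ℕ} (A B : ℂ) {x : Fin (n + 1) → ℂ}
    (hx : Function.Injective x) (hx0 : ∀ i, x i ≠ 0) :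
    (A + B) * ∑ k, ∏ i ∈ Finset.univ.erase k, (A * x i + B * x k) / (x i - x k) =
      A ^ (n + 1) - (-B) ^ (n + 1) := by
  set P : Polynomial ℂ := ∏ i, (Polynomial.C B * Polynomial.X + Polynomial.C (A * x i)) with hP
  have hdeg : ∀ i ∈ (Finset.univ : Finset (Fin (n + 1))),
      (Polynomial.C B * Polynomial.X + Polynomial.C (A * x i)).natDegree ≤ 1 :=
    fun i _ => Polynomial.natDegree_linear_le
  have hPdeg : P.natDegree ≤ n + 1 := by
    refine (Polynomial.natDegree_prod_le _ _).trans ?_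
    simpa using Finset.sum_le_sum hdeg
  have hcoeff : P.coeff (n + 1) = B ^ (n + 1) := by
    have := Polynomial.coeff_prod_of_natDegree_le Finset.univ _ 1 hdeg
    rw [Finset.card_univ, Fintype.card_fin, mul_one] at this
    rw [hP, this]
    simp [Polynomial.coeff_C]
  have heval : ∀ z, P.eval z = ∏ i, (B * z + A * x i) := fun z => by
    simp [hP, Polynomial.eval_prod]
  have hv : Set.InjOn (Fin.cons 0 x : Fin (n + 2) → ℂ) (Finset.univ : Finset (Fin (n + 2))) := by
    refine Function.Injective.injOn (Fin.cons_injective_iff.2 ⟨?_, hx⟩)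
    rintro ⟨i, hi⟩
    exact hx0 i hi
  have hL := Lagrange.coeff_eq_sum (s := Finset.univ) hv (P := P) (by
    refine lt_of_le_of_lt Polynomial.degree_le_natDegree ?_
    rw [Finset.card_univ, Fintype.card_fin]
    exact_mod_cast Nat.lt_succ_of_le hPdeg)
  rw [Finset.card_univ, Fintype.card_fin, show n + 2 - 1 = n + 1 from rfl, hcoeff] at hL
  simp only [prod_erase_eq_prod_ite] at hL ⊢
  rw [Fin.sum_univ_succ] at hL
  simp only [Fin.prod_univ_succ (n := n + 1), Fin.cons_zero, Fin.cons_succ, heval, Fin.succ_ne_zero,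
    Fin.succ_inj, if_true, if_false, one_mul, mul_zero, zero_add, sub_zero, zero_sub,
    (Fin.succ_ne_zero _).symm] at hL
  have h0 : (∏ i, A * x i) / ∏ i, -x i = (-A) ^ (n + 1) := by
    rw [← Finset.prod_div_distrib, Finset.prod_congr rfl fun i _ => show A * x i / -x i = -A by
      rw [div_neg, mul_div_cancel_right₀ _ (hx0 i)]]
    simp
  have hk : ∀ k, (∏ i, (B * x k + A * x i)) /
      (x k * ∏ i, if i = k then 1 else x k - x i) =
      (-1) ^ n * ((A + B) *
        ∏ i, if i = k then 1 else (A * x i + B * x k) / (x i - x k)) := by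
    intro k
    simp only [← prod_erase_eq_prod_ite]
    rw [← Finset.mul_prod_erase Finset.univ _ (Finset.mem_univ k), mul_div_mul_comm,
      ← Finset.prod_div_distrib]
    have h1 : (B * x k + A * x k) / x k = A + B := by
      have := hx0 k
      field_simp
      ring
    have h2 : ∏ i ∈ Finset.univ.erase k, (B * x k + A * x i) / (x k - x i) =
        ∏ i ∈ Finset.univ.erase k, (-1) * ((A * x i + B * x k) / (x i - x k)) := by
      refine Finset.prod_congr rfl fun i _ => ?_
      rw [← neg_sub (x i), div_neg, add_comm (B * x k), neg_one_mul]
    rw [h1, h2, Finset.prod_mul_distrib, Finset.prod_const, Finset.card_erase_of_mem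
      (Finset.mem_univ k), Finset.card_univ, Fintype.card_fin, Nat.add_sub_cancel]
    ring
  rw [h0, Finset.sum_congr rfl fun k _ => hk k, ← Finset.mul_sum, ← Finset.mul_sum] at hL
  have h3 : ((-1 : ℂ) ^ n) * (-1) ^ n = 1 := by rw [← mul_pow]; simp
  rw [neg_pow A, pow_succ (-1 : ℂ)] at hL
  rw [neg_pow B, pow_succ (-1 : ℂ)]
  linear_combination (-(-1) ^ n) * hL +
    (A ^ (n + 1) - (A + B) * ∑ k, ∏ i, if i = k then 1 else (A * x i + B * x k) / (x i - x k)) * h3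

/-- The leading coefficient of a polynomial of too small a degree vanishes. -/
theorem sum_pow_div_prod_sub_eq_zero {n p : ℕ} (hp : p < n) {x : Fin (n + 1) → ℂ}
    (hx : Function.Injective x) :
    ∑ k, x k ^ p / ∏ i ∈ Finset.univ.erase k, (x i - x k) = 0 := by
  have hL := Lagrange.coeff_eq_sum (s := Finset.univ) hx.injOn
    (P := (Polynomial.X ^ p : Polynomial ℂ)) (by
      rw [Polynomial.degree_X_pow, Finset.card_univ, Fintype.card_fin]
      exact_mod_cast hp.trans (Nat.lt_succ_self n))
  rw [Finset.card_univ, Fintype.card_fin, Nat.add_sub_cancel, Polynomial.coeff_X_pow,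
    if_neg hp.ne'] at hL
  have hsign : ∀ k, x k ^ p / ∏ i ∈ Finset.univ.erase k, (x i - x k) =
      (-1) ^ n * (x k ^ p / ∏ i ∈ Finset.univ.erase k, (x k - x i)) := by
    intro k
    have : ∏ i ∈ Finset.univ.erase k, (x i - x k) =
        (-1) ^ n * ∏ i ∈ Finset.univ.erase k, (x k - x i) := by
      rw [Finset.prod_congr rfl fun i _ => show x i - x k = (-1) * (x k - x i) by ring,
        Finset.prod_mul_distrib, Finset.prod_const, Finset.card_erase_of_mem (Finset.mem_univ k),
        Finset.card_univ, Fintype.card_fin, Nat.add_sub_cancel]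
    have h1 : ((-1 : ℂ) ^ n)⁻¹ = (-1) ^ n := by rw [← inv_pow]; norm_num
    rw [this, div_mul_eq_div_div, div_eq_mul_inv (x k ^ p), h1]
    ring
  simp only [Polynomial.eval_pow, Polynomial.eval_X] at hL
  rw [Finset.sum_congr rfl fun k _ => hsign k, ← Finset.mul_sum, ← hL, mul_zero]

theorem injective_exp_mul_of_norm_lt {m : ℕ} {c : ℂ} (hc : c ≠ 0) {u : Fin m → ℂ}
    (hu : ∀ i, ‖c * u i‖ < Real.pi) (hui : Function.Injective u) :
    Function.Injective fun i => Complex.exp (c * u i) := by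
  have him : ∀ i, |(c * u i).im| < Real.pi := fun i => (Complex.abs_im_le_norm _).trans_lt (hu i)
  intro i k hik
  have h := Complex.exp_inj_of_neg_pi_lt_of_le_pi (abs_lt.1 (him i)).1 (abs_lt.1 (him i)).2.le
    (abs_lt.1 (him k)).1 (abs_lt.1 (him k)).2.le hik
  exact hui (mul_left_cancel₀ hc h)

theorem eventually_injective_exp_mul {m : ℕ} {c : ℂ} (hc : c ≠ 0) :
    ∀ᶠ u : Fin m → ℂ in 𝓝 0, Function.Injective u →
      Function.Injective fun i => Complex.exp (c * u i) := by
  have h : ∀ᶠ u : Fin m → ℂ in 𝓝 0, ∀ i, ‖c * u i‖ < Real.pi := by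
    refine eventually_all.2 fun i => ?_
    have hcont : Continuous fun u : Fin m → ℂ => ‖c * u i‖ := by fun_prop
    refine hcont.continuousAt.eventually (gt_mem_nhds ?_)
    simpa using Real.pi_pos
  filter_upwards [h] with u hu hui using injective_exp_mul_of_norm_lt hc hu hui

theorem one_div_toddFun_sub {α β : ℂ} (h : α ≠ β) (a b : ℂ) :
    1 / toddFun α β (a - b) =
      (-β * Complex.exp ((α - β) * a) + α * Complex.exp ((α - β) * b)) /
        (Complex.exp ((α - β) * a) - Complex.exp ((α - β) * b)) := by
  have h1 : Complex.exp (α * (a - b)) * 1 =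
      Complex.exp (β * (a - b) - (α - β) * b) * Complex.exp ((α - β) * a) := by
    rw [mul_one, ← Complex.exp_add]
    congr 1
    ring
  have h2 : Complex.exp (β * (a - b)) * 1 =
      Complex.exp (β * (a - b) - (α - β) * b) * Complex.exp ((α - β) * b) := by
    rw [mul_one, ← Complex.exp_add]
    congr 1
    ring
  rw [mul_one] at h1 h2
  rw [toddFun, if_neg h, one_div_div, h1, h2, mul_left_comm α, mul_left_comm β, ← mul_sub,
    ← mul_sub, mul_div_mul_left _ _ (Complex.exp_ne_zero _)]
  ring

theorem hirzebruchSum_toddFun {n : ℕ} {α β : ℂ} (h : α ≠ β) {u : Fin (n + 1) → ℂ}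
    (hu : Function.Injective fun i => Complex.exp ((α - β) * u i)) :
    hirzebruchSum (fun t => 1 / toddFun α β t) u =
      ((-β) ^ (n + 1) - (-α) ^ (n + 1)) / (α - β) := by
  rw [eq_div_iff (sub_ne_zero.2 h), mul_comm, ← add_mul_sum_prod_div_sub (-β) α hu
    fun i => Complex.exp_ne_zero _, neg_add_eq_sub]
  simp only [hirzebruchSum, one_div_toddFun_sub h]

/-- The one-parametric Todd genus is a limit of two-parametric ones. -/
theorem tendsto_one_div_toddFun (α : ℂ) {t : ℂ} (ht : t ≠ 0) :
    Tendsto (fun δ => 1 / toddFun (α + δ) α t) (𝓝[≠] 0) (𝓝 (1 / toddFun α α t)) := by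
  have hd : HasDerivAt (fun δ => Complex.exp (δ * t)) t 0 := by
    have h : HasDerivAt (fun δ : ℂ => δ * t) t 0 := by
      simpa using (hasDerivAt_id (0 : ℂ)).mul_const t
    simpa using h.cexp
  have h1 := ((hasDerivAt_iff_tendsto_slope.1 hd).inv₀ ht).sub_const α
  have h2 : t⁻¹ - α = 1 / toddFun α α t := by
    rw [toddFun, if_pos rfl]
    field_simp
  rw [← h2]
  refine h1.congr' ?_
  have hnear : ∀ᶠ δ : ℂ in 𝓝[≠] 0, slope (fun δ => Complex.exp (δ * t)) 0 δ ≠ 0 :=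
    (hasDerivAt_iff_tendsto_slope.1 hd).eventually_ne ht
  filter_upwards [self_mem_nhdsWithin, hnear] with δ hδ hs
  have hδ0 : δ ≠ 0 := hδ
  simp only [slope, vsub_eq_sub, sub_zero, zero_mul, Complex.exp_zero, smul_eq_mul] at hs ⊢
  have hne : Complex.exp (δ * t) - 1 ≠ 0 := right_ne_zero_of_mul hs
  rw [toddFun, if_neg (by simpa using hδ0), one_div_div, add_mul α δ t, Complex.exp_add]
  have he := Complex.exp_ne_zero (α * t)
  rw [show Complex.exp (α * t) * Complex.exp (δ * t) - Complex.exp (α * t) =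
    Complex.exp (α * t) * (Complex.exp (δ * t) - 1) by ring, eq_div_iff (mul_ne_zero he hne),
    mul_inv_rev, inv_inv]
  field_simp
  ring

theorem tendsto_hirzebruchSum {ι : Type*} {l : Filter ι} {h : ι → ℂ → ℂ} {h₀ : ℂ → ℂ}
    (hlim : ∀ t ≠ 0, Tendsto (fun δ => h δ t) l (𝓝 (h₀ t))) {m : ℕ} {u : Fin m → ℂ}
    (hu : Function.Injective u) :
    Tendsto (fun δ => hirzebruchSum (h δ) u) l (𝓝 (hirzebruchSum h₀ u)) :=
  tendsto_finsetSum _ fun _ _ => tendsto_finsetProd _ fun _ hi =>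
    hlim _ (sub_ne_zero.2 (hu.ne (Finset.ne_of_mem_erase hi)))

theorem solvesHirzebruchEquation_toddFun (n : ℕ) (α β : ℂ) :
    SolvesHirzebruchEquation n (toddFun α β) := by
  rw [solvesHirzebruchEquation_iff]
  by_cases h : α = β
  · subst h
    -- the sums of the approximating Todd genera do not depend on the tuple
    have key : ∀ u w : Fin (n + 1) → ℂ, Function.Injective u → Function.Injective w →
        hirzebruchSum (fun t => 1 / toddFun α α t) u =
          hirzebruchSum (fun t => 1 / toddFun α α t) w := by
      intro u w hu hw
      have hev : ∀ u : Fin (n + 1) → ℂ, Function.Injective u → ∀ᶠ δ : ℂ in 𝓝[≠] 0,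
          Function.Injective fun i => Complex.exp ((α + δ - α) * u i) := by
        intro u hu
        have h1 : ∀ᶠ δ : ℂ in 𝓝[≠] 0, ∀ i, ‖δ * u i‖ < Real.pi := by
          refine nhdsWithin_le_nhds (eventually_all.2 fun i => ?_)
          have hcont : Continuous fun δ : ℂ => ‖δ * u i‖ := by fun_prop
          refine hcont.continuousAt.eventually (gt_mem_nhds ?_)
          simpa using Real.pi_pos
        filter_upwards [h1, self_mem_nhdsWithin] with δ hδ hδ0
        simpa using injective_exp_mul_of_norm_lt hδ0 hδ hu
      refine tendsto_nhds_unique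
        (tendsto_hirzebruchSum (fun t ht => tendsto_one_div_toddFun α ht) hu)
        ((tendsto_hirzebruchSum (fun t ht => tendsto_one_div_toddFun α ht) hw).congr' ?_)
      filter_upwards [hev u hu, hev w hw, self_mem_nhdsWithin] with δ h1 h2 hδ
      have hne : α + δ ≠ α := by simpa using hδ
      rw [hirzebruchSum_toddFun hne h1, hirzebruchSum_toddFun hne h2]
    have hinj : Function.Injective fun i : Fin (n + 1) => (i.val : ℂ) := fun i k hik => by
      have h1 : (i.val : ℂ) = k.val := hik
      exact Fin.ext (by exact_mod_cast h1)
    exact ⟨_, .of_forall fun u hu => key u _ hu hinj⟩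
  · refine ⟨((-β) ^ (n + 1) - (-α) ^ (n + 1)) / (α - β), ?_⟩
    filter_upwards [eventually_injective_exp_mul (sub_ne_zero.2 h)] with u hu hui
    exact hirzebruchSum_toddFun h (hu hui)

/-- With `x i = exp (2 μ u i)` and `K = k (n + 1) / d`, the Hirzebruch sum of a degenerate elliptic
function is a multiple of `∑ k, x k ^ (K - 1) / ∏ i ≠ k, (x i - x k)`, which vanishes since
`0 < K < n + 1`. -/
theorem IsDegenerateEllipticOfLevel.solvesHirzebruchEquation {n d : ℕ} (hdn : d ∣ n + 1)
    {f : ℂ → ℂ} (hf : IsDegenerateEllipticOfLevel d f) : SolvesHirzebruchEquation n f := by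
  obtain ⟨k, μ, hk0, hkd, hμ, rfl⟩ := hf
  obtain ⟨m, hm⟩ := hdn
  have hm0 : 0 < m := Nat.pos_of_ne_zero fun h => by simp [h] at hm
  have hd0 : (d : ℂ) ≠ 0 := by exact_mod_cast (hk0.trans hkd).ne'
  obtain ⟨p, hp⟩ : ∃ p, k * m = p + 1 := ⟨k * m - 1, by
    have := Nat.mul_pos hk0 hm0
    omega⟩
  have hpn : p < n := by
    have := Nat.mul_lt_mul_of_pos_right hkd hm0
    omega
  have hpc : (k : ℂ) * m = p + 1 := by exact_mod_cast hp
  have hmc : (n : ℂ) + 1 = d * m := by exact_mod_cast hm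
  set γ : ℂ := (2 - 2 * k / d) * μ with hγ
  rw [solvesHirzebruchEquation_iff]
  refine ⟨0, ?_⟩
  have h2μ : 2 * μ ≠ 0 := mul_ne_zero two_ne_zero hμ
  filter_upwards [eventually_injective_exp_mul h2μ] with u hu hui
  set x : Fin (n + 1) → ℂ := fun i => Complex.exp (2 * μ * u i) with hx
  set E : Fin (n + 1) → ℂ := fun i => Complex.exp (γ * u i) with hE
  have hE0 : ∀ i, E i ≠ 0 := fun i => Complex.exp_ne_zero _
  have hterm : ∀ i k', i ≠ k' → 1 / (Complex.exp ((2 * k / d - 1) * μ * (u i - u k')) *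
      Complex.sinh (μ * (u i - u k')) / μ) = 2 * μ * x k' / E k' * (E i / (x i - x k')) := by
    intro i k' hik
    have hxne : x i - x k' ≠ 0 := sub_ne_zero.2 ((hu hui).ne hik)
    have h1 : Complex.exp ((2 * k / d - 1) * μ * (u i - u k')) * Complex.sinh (μ * (u i - u k')) =
        E k' * (x i - x k') / (2 * E i * x k') := by
      rw [eq_div_iff (by simp [hE, hx, Complex.exp_ne_zero]), Complex.sinh]
      have e1 : Complex.exp ((2 * k / d - 1) * μ * (u i - u k')) *
          Complex.exp (μ * (u i - u k')) * (E i * x k') = E k' * x i := by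
        simp only [hE, hx, ← Complex.exp_add]
        congr 1
        rw [hγ]
        ring
      have e2 : Complex.exp ((2 * k / d - 1) * μ * (u i - u k')) *
          Complex.exp (-(μ * (u i - u k'))) * (E i * x k') = E k' * x k' := by
        simp only [hE, hx, ← Complex.exp_add]
        congr 1
        rw [hγ]
        ring
      linear_combination e1 - e2
    rw [h1]
    have := hE0 i
    have := hE0 k'
    have : x k' ≠ 0 := Complex.exp_ne_zero _
    field_simp
  have hpow : ∀ k', x k' ^ n = x k' ^ p * E k' ^ (n + 1) := by
    intro k'
    simp only [hE, hx, ← Complex.exp_nat_mul, ← Complex.exp_add]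
    congr 1
    push_cast
    rw [hγ, hmc, show (n : ℂ) = d * m - 1 by rw [← hmc]; ring,
      show (p : ℂ) = k * m - 1 by rw [hpc]; ring]
    field_simp
    ring
  have hprod : ∀ k', ∏ i ∈ Finset.univ.erase k', 1 / (Complex.exp ((2 * k / d - 1) * μ *
      (u i - u k')) * Complex.sinh (μ * (u i - u k')) / μ) = ((2 * μ) ^ n * ∏ i, E i) *
        (x k' ^ p / ∏ i ∈ Finset.univ.erase k', (x i - x k')) := by
    intro k'
    rw [Finset.prod_congr rfl fun i hi => hterm i k' (Finset.ne_of_mem_erase hi),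
      Finset.prod_mul_distrib, Finset.prod_const, Finset.card_erase_of_mem (Finset.mem_univ k'),
      Finset.card_univ, Fintype.card_fin, Nat.add_sub_cancel, Finset.prod_div_distrib,
      ← Finset.mul_prod_erase Finset.univ E (Finset.mem_univ k'), div_pow, mul_pow, hpow k',
      pow_succ]
    have := hE0 k'
    field_simp
  rw [hirzebruchSum, Finset.sum_congr rfl fun k' _ => hprod k', ← Finset.mul_sum,
    sum_pow_div_prod_sub_eq_zero hpn (hu hui), mul_zero]

/-! ### Degenerate Krichever genera -/

theorem one_div_degenerateKricheverFun_zero (lam q t : ℂ) :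
    1 / degenerateKricheverFun lam q 0 t = (1 + q * t) / t * Complex.exp (-(lam * t)) := by
  rw [degenerateKricheverFun, if_pos rfl, one_div_div, Complex.exp_neg, div_mul_eq_div_div,
    div_eq_mul_inv (_ / _)]

theorem degenerateKricheverFun_neg (lam q η : ℂ) :
    degenerateKricheverFun lam q (-η) = degenerateKricheverFun lam q η := by
  funext t
  simp only [degenerateKricheverFun, neg_eq_zero, neg_mul, Complex.sinh_neg, Complex.cosh_neg,
    mul_neg]
  split_ifs
  · rfl
  · rw [← neg_add, neg_div_neg_eq]

theorem one_div_degenerateKricheverFun {lam q η : ℂ} (hη : η ≠ 0) (t : ℂ) :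
    1 / degenerateKricheverFun lam q η t =
      Complex.exp (-(lam * t)) * ((q + η) * Complex.exp (2 * η * t) + (η - q)) /
        (Complex.exp (2 * η * t) - 1) := by
  have h1 : Complex.exp (η * t) = Complex.exp (-(η * t)) * Complex.exp (2 * η * t) := by
    rw [← Complex.exp_add]
    congr 1
    ring
  have h2 : Complex.sinh (η * t) =
      Complex.exp (-(η * t)) / 2 * (Complex.exp (2 * η * t) - 1) := by
    rw [Complex.sinh, h1]
    ring
  have h3 : q * Complex.sinh (η * t) + η * Complex.cosh (η * t) =
      Complex.exp (-(η * t)) / 2 * ((q + η) * Complex.exp (2 * η * t) + (η - q)) := by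
    rw [Complex.sinh, Complex.cosh, h1]
    ring
  have he := Complex.exp_ne_zero (-(η * t))
  rw [degenerateKricheverFun, if_neg hη, one_div_div, h3, h2, mul_left_comm,
    mul_div_mul_left _ _ (div_ne_zero he two_ne_zero), div_mul_eq_div_div, Complex.exp_neg,
    div_eq_mul_inv (_ + _), mul_comm (_ + _), mul_div_assoc]

theorem degenerateKricheverFun_eq_toddFun (q η : ℂ) :
    degenerateKricheverFun 0 q η = toddFun (-q + η) (-q - η) := by
  funext t
  by_cases hη : η = 0
  · subst hη
    simp [degenerateKricheverFun, toddFun]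
  · have hne : -q + η ≠ -q - η := fun h => hη (by linear_combination h / 2)
    have he := Complex.exp_ne_zero (-(q * t))
    have h1 : Complex.exp ((-q + η) * t) = Complex.exp (-(q * t)) * Complex.exp (η * t) := by
      rw [← Complex.exp_add]
      congr 1
      ring
    have h2 : Complex.exp ((-q - η) * t) = Complex.exp (-(q * t)) * Complex.exp (-(η * t)) := by
      rw [← Complex.exp_add]
      congr 1
      ring
    rw [degenerateKricheverFun, if_neg hη, toddFun, if_neg hne, h1, h2, zero_mul,
      Complex.exp_zero, one_mul, mul_left_comm (-q + η), mul_left_comm (-q - η), ← mul_sub,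
      ← mul_sub, mul_div_mul_left _ _ he, Complex.sinh, Complex.cosh,
      ← mul_div_mul_left _ _ (two_ne_zero (α := ℂ))]
    congr 1 <;> ring

theorem degenerateKricheverFun_self {η : ℂ} (hη : η ≠ 0) (lam t : ℂ) :
    degenerateKricheverFun lam η η t =
      Complex.exp ((lam - η) * t) * Complex.sinh (η * t) / η := by
  rw [degenerateKricheverFun, if_neg hη, ← mul_add, Complex.sinh_add_cosh, sub_mul,
    Complex.exp_sub]
  have := Complex.exp_ne_zero (η * t)
  field_simp

/-- In the cuspidal case only the Todd genera are solutions: if `lam ≠ 0`, then the factor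
`exp (-lam t)` decides the behaviour of `1 / f` in the direction of `1 / lam`. -/
theorem eq_zero_of_solvesHirzebruchEquation {n : ℕ} (hn : 1 ≤ n) {lam q : ℂ}
    (h : SolvesHirzebruchEquation n (degenerateKricheverFun lam q 0)) : lam = 0 := by
  by_contra hlam
  obtain ⟨C, hC⟩ := solvesHirzebruchEquation_iff.1 h
  have hinv : lam⁻¹ ≠ 0 := inv_ne_zero hlam
  -- the points `r / lam + c` leave every bounded set
  have hnorm : ∀ c, Tendsto (fun r : ℝ => r * lam⁻¹ + c) atTop (Bornology.cobounded ℂ) := by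
    intro c
    rw [← tendsto_norm_atTop_iff_cobounded]
    refine tendsto_atTop_mono (fun r => ?_) (tendsto_atTop_add_const_right atTop (-‖c‖)
      ((tendsto_id (α := ℝ)).atTop_mul_const (norm_pos_iff.2 hinv)))
    calc r * ‖lam⁻¹‖ + -‖c‖ ≤ ‖(r : ℂ) * lam⁻¹‖ - ‖c‖ := by
          rw [norm_mul, ← sub_eq_add_neg, Complex.norm_real]
          gcongr
          exact Real.le_norm_self r
      _ ≤ ‖(r : ℂ) * lam⁻¹ + c‖ := by
          rw [sub_le_iff_le_add]
          simpa using norm_sub_le ((r : ℂ) * lam⁻¹ + c) c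
  have hfrac : ∀ t : ℂ, t ≠ 0 → (1 + q * t) / t = t⁻¹ + q := fun t ht => by field_simp
  have hexp : Tendsto (fun r : ℝ => Complex.exp (-r)) atTop (𝓝 0) := by
    rw [tendsto_zero_iff_norm_tendsto_zero]
    simpa [Complex.norm_exp] using Real.tendsto_exp_neg_atTop_nhds_zero
  have hne : ∀ c, ∀ᶠ r : ℝ in atTop, (r : ℂ) * lam⁻¹ + c ≠ 0 := fun c =>
    (hnorm c).eventually (Bornology.eventually_ne_cobounded 0)
  refine not_solution_of_tendsto (Λ := ⊥) (a := lam⁻¹) (by simp) (by simp) (fun z hz => ?_) hn hC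
    (fun c => by simpa using hne c) (fun c => ?_) (fun c => ?_)
  · have hz0 : z ≠ 0 := by simpa using hz
    simp only [one_div_degenerateKricheverFun_zero]
    fun_prop (disch := exact hz0)
  · have h1 := ((((tendsto_inv₀_cobounded.comp (hnorm c)).add_const q).mul hexp).mul_const
      (Complex.exp (-(lam * c))))
    simp only [zero_add, mul_zero, zero_mul] at h1
    refine h1.congr' ?_
    filter_upwards [hne c] with r hr
    rw [one_div_degenerateKricheverFun_zero, hfrac _ hr, mul_assoc, ← Complex.exp_add]
    simp only [Function.comp]
    congr 2
    field_simp
    ring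
  · have hne' : ∀ᶠ r : ℝ in atTop, c - (r : ℂ) * lam⁻¹ ≠ 0 := by
      filter_upwards [hne (-c)] with r hr h0
      exact hr (by linear_combination -h0)
    have hmain : Tendsto (fun r : ℝ => ‖(c - (r : ℂ) * lam⁻¹)⁻¹ + q‖ * Real.exp r) atTop atTop := by
      by_cases hq : q = 0
      · subst hq
        have h2 := (Real.tendsto_exp_div_pow_atTop 1).const_mul_atTop
          (show 0 < (‖c‖ + ‖lam⁻¹‖)⁻¹ by
            have := norm_pos_iff.2 hinv
            positivity)
        refine tendsto_atTop_mono' _ ?_ h2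
        filter_upwards [hne', eventually_ge_atTop 1] with r hr hr1
        rw [add_zero, norm_inv (c - _), pow_one, mul_div_assoc', mul_comm, mul_comm _ (Real.exp r),
          mul_div_assoc]
        refine mul_le_mul_of_nonneg_left ?_ (Real.exp_pos r).le
        rw [div_eq_mul_inv, ← mul_inv]
        refine inv_anti₀ (norm_pos_iff.2 hr) ?_
        calc ‖c - (r : ℂ) * lam⁻¹‖ ≤ ‖c‖ + ‖(r : ℂ) * lam⁻¹‖ := norm_sub_le _ _
          _ ≤ ‖c‖ * r + ‖lam⁻¹‖ * r := by
              rw [norm_mul, Complex.norm_of_nonneg (by linarith), mul_comm r]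
              gcongr
              exact le_mul_of_one_le_right (norm_nonneg c) hr1
          _ = (‖c‖ + ‖lam⁻¹‖) * r := by ring
      · have h3 : Tendsto (fun r : ℝ => (c - (r : ℂ) * lam⁻¹)⁻¹ + q) atTop (𝓝 q) := by
          have := (tendsto_inv₀_cobounded.comp (hnorm (-c))).neg.add_const q
          rw [neg_zero, zero_add] at this
          refine this.congr fun r => ?_
          simp only [Function.comp]
          rw [← inv_neg]
          congr 2
          ring
        exact h3.norm.pos_mul_atTop (norm_pos_iff.2 hq) Real.tendsto_exp_atTop
    refine (hmain.atTop_mul_const (norm_pos_iff.2 (Complex.exp_ne_zero (-(lam * c))))).congr' ?_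
    filter_upwards [hne'] with r hr
    rw [one_div_degenerateKricheverFun_zero, hfrac _ hr]
    have h4 : Complex.exp (-(lam * (c - (r : ℂ) * lam⁻¹))) =
        Complex.exp (r : ℂ) * Complex.exp (-(lam * c)) := by
      rw [← Complex.exp_add]
      congr 1
      field_simp
      ring
    rw [h4, norm_mul, norm_mul, ← Complex.ofReal_exp, Complex.norm_of_nonneg (Real.exp_pos r).le,
      mul_assoc]

theorem exp_two_mul_eq_one_iff {η : ℂ} (hη : η ≠ 0) (z : ℂ) :
    Complex.exp (2 * η * z) = 1 ↔ z ∈ AddSubgroup.zmultiples (Real.pi * Complex.I / η) := by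
  rw [Complex.exp_eq_one_iff, AddSubgroup.mem_zmultiples_iff]
  refine exists_congr fun m => ?_
  rw [zsmul_eq_mul]
  constructor
  · intro h
    field_simp
    linear_combination -h / 2
  · rintro rfl
    field_simp

theorem isClosed_zmultiples {η : ℂ} (hη : η ≠ 0) :
    IsClosed (AddSubgroup.zmultiples (Real.pi * Complex.I / η) : Set ℂ) := by
  have : (AddSubgroup.zmultiples (Real.pi * Complex.I / η) : Set ℂ) =
      (fun z => Complex.exp (2 * η * z)) ⁻¹' {1} := by
    ext z
    simpa using (exp_two_mul_eq_one_iff hη z).symm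
  rw [this]
  exact isClosed_singleton.preimage (by fun_prop)

theorem countable_zmultiples (ω : ℂ) : (AddSubgroup.zmultiples ω : Set ℂ).Countable :=
  Set.countable_range fun m : ℤ => m • ω

theorem differentiableAt_one_div_degenerateKricheverFun {lam q η : ℂ} (hη : η ≠ 0) {z : ℂ}
    (hz : z ∉ AddSubgroup.zmultiples (Real.pi * Complex.I / η)) :
    DifferentiableAt ℂ (fun t => 1 / degenerateKricheverFun lam q η t) z := by
  simp only [one_div_degenerateKricheverFun hη]
  exact DifferentiableAt.div (by fun_prop) (by fun_prop)
    (sub_ne_zero.2 fun h => hz ((exp_two_mul_eq_one_iff hη z).1 h))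

theorem tendsto_degenerateKricheverFun_div {lam q η : ℂ} (hη : η ≠ 0) :
    Tendsto (fun t => degenerateKricheverFun lam q η t / t) (𝓝[≠] 0) (𝓝 1) := by
  have hd : HasDerivAt (fun t => Complex.sinh (η * t)) η 0 := by
    have h : HasDerivAt (fun t : ℂ => η * t) η 0 := by
      simpa using (hasDerivAt_id (0 : ℂ)).const_mul η
    simpa using h.csinh
  have hc : ContinuousAt (fun t => Complex.exp (lam * t) /
      (q * Complex.sinh (η * t) + η * Complex.cosh (η * t))) 0 :=
    ContinuousAt.div (by fun_prop) (by fun_prop) (by simpa using hη)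
  have h := (hc.tendsto.mono_left (nhdsWithin_le_nhds (s := {0}ᶜ))).mul
    (hasDerivAt_iff_tendsto_slope.1 hd)
  simp only [mul_zero, Complex.exp_zero, Complex.sinh_zero, Complex.cosh_zero, zero_add, mul_one,
    one_div, inv_mul_cancel₀ hη] at h
  refine h.congr fun t => ?_
  simp only [slope, mul_zero, Complex.sinh_zero, vsub_eq_sub, sub_zero, smul_eq_mul,
    degenerateKricheverFun, if_neg hη]
  ring

/-- In the nodal case the exponent `lam` is an integral multiple of `2 η / (n + 1)`, since
`π i / η` is a quasi-period of `1 / f` with multiplier `exp (-lam π i / η)`. -/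
theorem exists_int_mul_eq {n : ℕ} (hn : 1 ≤ n) {lam q η : ℂ} (hη : η ≠ 0)
    (h : SolvesHirzebruchEquation n (degenerateKricheverFun lam q η)) :
    ∃ K : ℤ, lam * (n + 1) = 2 * η * K := by
  obtain ⟨C, hC⟩ := solvesHirzebruchEquation_iff.1 h
  set ω := Real.pi * Complex.I / η with hω
  have hωm : ω ∈ AddSubgroup.zmultiples ω := AddSubgroup.mem_zmultiples ω
  have hper : ∀ z, 1 / degenerateKricheverFun lam q η (z + ω) =
      Complex.exp (-(lam * ω)) * (1 / degenerateKricheverFun lam q η z) := by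
    intro z
    rw [one_div_degenerateKricheverFun hη, one_div_degenerateKricheverFun hη,
      mul_add (2 * η), Complex.exp_add (2 * η * z), (exp_two_mul_eq_one_iff hη ω).2 hωm, mul_one,
      mul_add lam, neg_add, Complex.exp_add]
    ring
  have h1 := multiplier_pow_eq_one (isClosed_zmultiples hη) (countable_zmultiples _)
    (fun z hz => differentiableAt_one_div_degenerateKricheverFun hη hz)
    (tendsto_norm_atTop_of_tendsto_mul
      (tendsto_mul_one_div_of_tendsto_div (tendsto_degenerateKricheverFun_div hη))) hn hC hωm
    (Complex.exp_ne_zero _) hper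
  rw [← Complex.exp_nat_mul, Complex.exp_eq_one_iff] at h1
  obtain ⟨m, hm⟩ := h1
  refine ⟨-m, ?_⟩
  have hpi : (Real.pi : ℂ) * Complex.I ≠ 0 :=
    mul_ne_zero (by exact_mod_cast Real.pi_ne_zero) Complex.I_ne_zero
  rw [hω] at hm
  push_cast at hm ⊢
  field_simp at hm
  refine mul_left_cancel₀ hpi ?_
  linear_combination -(Real.pi * Complex.I) * hm

/-- If `lam` is a positive multiple `2 η K / (n + 1)`, then `1 / f` tends to zero in the direction
of `1 / (2 η)`; it must not tend to infinity in the opposite one, where it behaves like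
`exp (-lam t)` if `q ≠ η`, and like `exp ((2 η - lam) t)` if `q = η`. -/
theorem eq_and_le_of_solvesHirzebruchEquation {n : ℕ} (hn : 1 ≤ n) {lam q η : ℂ} (hη : η ≠ 0)
    (h : SolvesHirzebruchEquation n (degenerateKricheverFun lam q η)) {K : ℕ} (hK : 0 < K)
    (hlam : lam * (n + 1) = 2 * η * K) : q = η ∧ K ≤ n + 1 := by
  by_contra hcon
  obtain ⟨C, hC⟩ := solvesHirzebruchEquation_iff.1 h
  set κ : ℝ := K / (n + 1) with hκ
  have hn0 : (n : ℂ) + 1 ≠ 0 := by exact_mod_cast n.succ_ne_zero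
  have hκ0 : 0 < κ := by positivity
  have hlam' : lam = 2 * η * κ := by
    rw [hκ]
    push_cast
    field_simp
    linear_combination hlam
  have h2η : 2 * η ≠ 0 := mul_ne_zero two_ne_zero hη
  have hexp : ∀ a : ℝ, 0 < a → Tendsto (fun r : ℝ => Complex.exp (-(a * r))) atTop (𝓝 0) := by
    intro a ha
    rw [tendsto_zero_iff_norm_tendsto_zero]
    have := Real.tendsto_exp_neg_atTop_nhds_zero.comp (tendsto_id.const_mul_atTop ha)
    simpa [Complex.norm_exp, Function.comp_def] using this
  have hexpi : ∀ a : ℝ, 0 < a → Tendsto (fun r : ℝ => ‖Complex.exp (a * r)‖) atTop atTop := by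
    intro a ha
    have := Real.tendsto_exp_atTop.comp (tendsto_id.const_mul_atTop ha)
    simpa [Complex.norm_exp, Function.comp_def] using this
  have hx : ∀ (c : ℂ) (r : ℝ), Complex.exp (2 * η * (r * (2 * η)⁻¹ + c)) =
      Complex.exp r * Complex.exp (2 * η * c) := by
    intro c r
    rw [← Complex.exp_add]
    congr 1
    field_simp
  have hl : ∀ (c : ℂ) (r : ℝ), Complex.exp (-(lam * (r * (2 * η)⁻¹ + c))) =
      Complex.exp (-(κ * r)) * Complex.exp (-(lam * c)) := by
    intro c r
    rw [← Complex.exp_add, hlam']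
    congr 1
    field_simp
    ring
  have hX : ∀ c, Complex.exp (2 * η * c) ≠ 0 := fun c => Complex.exp_ne_zero _
  refine not_solution_of_tendsto (a := (2 * η)⁻¹) (isClosed_zmultiples hη) (countable_zmultiples _)
    (fun z hz => differentiableAt_one_div_degenerateKricheverFun hη hz) hn hC
    (fun c => ?_) (fun c => ?_) (fun c => ?_)
  · have h1 := (hexpi 1 one_pos).atTop_mul_const (norm_pos_iff.2 (hX c))
    filter_upwards [h1.eventually_gt_atTop 1] with r hr hmem
    rw [← exp_two_mul_eq_one_iff hη, hx] at hmem
    rw [← norm_mul, Complex.ofReal_one, one_mul, hmem, norm_one] at hr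
    exact lt_irrefl _ hr
  · -- numerator and denominator of the fraction are divided by `exp r`
    have h1 := hexp 1 one_pos
    have h2 : Tendsto (fun r : ℝ => Complex.exp (-(κ * r)) * Complex.exp (-(lam * c)) *
        (((q + η) * Complex.exp (2 * η * c) + (η - q) * Complex.exp (-((1 : ℝ) * r))) /
          (Complex.exp (2 * η * c) - Complex.exp (-((1 : ℝ) * r))))) atTop (𝓝 0) := by
      have := (((hexp κ hκ0).mul_const (Complex.exp (-(lam * c)))).mul
        (((h1.const_mul (η - q)).const_add ((q + η) * Complex.exp (2 * η * c))).div
          (h1.const_sub (Complex.exp (2 * η * c))) (by simp)))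
      rw [zero_mul, zero_mul] at this
      exact this
    refine h2.congr fun r => ?_
    have h3 : Complex.exp r * Complex.exp (-((1 : ℝ) * r)) = 1 := by
      rw [← Complex.exp_add]
      simp
    rw [one_div_degenerateKricheverFun hη, hx, hl,
      ← mul_div_mul_left _ _ (Complex.exp_ne_zero (r : ℂ)), ← mul_div_assoc]
    congr 1
    · linear_combination Complex.exp (-(κ * r)) * Complex.exp (-(lam * c)) * (η - q) * h3
    · linear_combination -h3
  · have hx' : ∀ r : ℝ, Complex.exp (2 * η * (c - r * (2 * η)⁻¹)) =
        Complex.exp (-((1 : ℝ) * r)) * Complex.exp (2 * η * c) := by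
      intro r
      have := hx c (-r)
      rw [Complex.ofReal_neg, neg_mul, neg_add_eq_sub] at this
      rw [this, Complex.ofReal_one, one_mul]
    have hl' : ∀ r : ℝ, Complex.exp (-(lam * (c - r * (2 * η)⁻¹))) =
        Complex.exp (κ * r) * Complex.exp (-(lam * c)) := by
      intro r
      have := hl c (-r)
      rw [Complex.ofReal_neg, neg_mul, neg_add_eq_sub] at this
      rw [this, mul_neg, neg_neg]
    have h1 := hexp 1 one_pos
    have hden : Tendsto (fun r : ℝ => Complex.exp (-((1 : ℝ) * r)) * Complex.exp (2 * η * c) - 1)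
        atTop (𝓝 (-1)) := by
      simpa using (h1.mul_const (Complex.exp (2 * η * c))).sub_const 1
    simp only [one_div_degenerateKricheverFun hη, hx', hl']
    by_cases hq : q = η
    · subst hq
      have hκ1 : 0 < κ - 1 := by
        have : n + 1 < K := by
          by_contra hle
          exact hcon ⟨rfl, not_lt.1 hle⟩
        rw [hκ, sub_pos, one_lt_div (by positivity)]
        exact_mod_cast this
      have h2 : Tendsto (fun r : ℝ => Complex.exp (-(lam * c)) *
          ((q + q) * Complex.exp (2 * q * c)) / (Complex.exp (-((1 : ℝ) * r)) *
            Complex.exp (2 * q * c) - 1)) atTop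
          (𝓝 (Complex.exp (-(lam * c)) * ((q + q) * Complex.exp (2 * q * c)) / (-1))) :=
        tendsto_const_nhds.div hden (by norm_num)
      refine ((hexpi _ hκ1).atTop_mul_pos (norm_pos_iff.2 ?_) h2.norm).congr fun r => ?_
      · refine div_ne_zero (mul_ne_zero (Complex.exp_ne_zero _) (mul_ne_zero ?_ (hX c)))
          (by norm_num)
        rwa [← two_mul]
      · rw [← norm_mul]
        congr 1
        have h4 : Complex.exp (((κ - 1 : ℝ) : ℂ) * r) =
            Complex.exp (κ * r) * Complex.exp (-((1 : ℝ) * r)) := by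
          rw [← Complex.exp_add]
          congr 1
          push_cast
          ring
        rw [h4]
        ring
    · have h2 : Tendsto (fun r : ℝ => Complex.exp (-(lam * c)) *
          ((q + η) * (Complex.exp (-((1 : ℝ) * r)) * Complex.exp (2 * η * c)) + (η - q)) /
            (Complex.exp (-((1 : ℝ) * r)) * Complex.exp (2 * η * c) - 1)) atTop
          (𝓝 (Complex.exp (-(lam * c)) * ((q + η) * (0 * Complex.exp (2 * η * c)) + (η - q)) /
            (-1))) :=
        ((((h1.mul_const _).const_mul _).add_const _).const_mul _).div hden (by norm_num)
      refine ((hexpi _ hκ0).atTop_mul_pos (norm_pos_iff.2 ?_) h2.norm).congr fun r => ?_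
      · refine div_ne_zero (mul_ne_zero (Complex.exp_ne_zero _) ?_) (by norm_num)
        simpa [sub_eq_zero] using Ne.symm hq
      · rw [← norm_mul]
        congr 1
        ring

/-- The case of a positive integer `K = lam (n + 1) / (2 η)`: the exponent `K = n + 1` gives the
Todd genus with parameters `2 η` and `0`, a smaller one a degenerate elliptic function of level
`n + 1`. -/
theorem toddFun_or_isDegenerate_of_pos {n : ℕ} (hn : 1 ≤ n) {lam q η : ℂ} (hη : η ≠ 0)
    (h : SolvesHirzebruchEquation n (degenerateKricheverFun lam q η)) {K : ℕ} (hK : 0 < K)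
    (hlam : lam * (n + 1) = 2 * η * K) :
    (∃ α β, degenerateKricheverFun lam q η = toddFun α β) ∨
      IsDegenerateEllipticOfLevel (n + 1) (degenerateKricheverFun lam q η) := by
  obtain ⟨rfl, hKn⟩ := eq_and_le_of_solvesHirzebruchEquation hn hη h hK hlam
  have hn0 : (n : ℂ) + 1 ≠ 0 := by exact_mod_cast n.succ_ne_zero
  rcases hKn.lt_or_eq with hlt | rfl
  · refine Or.inr ⟨K, q, hK, hlt, hη, funext fun t => ?_⟩
    rw [degenerateKricheverFun_self hη]
    congr 4
    push_cast
    field_simp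
    linear_combination hlam
  · refine Or.inl ⟨2 * q, 0, funext fun t => ?_⟩
    have hlam' : lam = 2 * q := mul_right_cancel₀ hn0 (by push_cast at hlam; exact hlam)
    have h1 : Complex.exp (2 * q * t) = Complex.exp (q * t) * Complex.exp (q * t) := by
      rw [← Complex.exp_add]
      congr 1
      ring
    have h2 : Complex.exp (q * t) * Complex.exp (-(q * t)) = 1 := by
      rw [← Complex.exp_add]
      simp
    rw [degenerateKricheverFun_self hη, toddFun, if_neg (mul_ne_zero two_ne_zero hη), hlam',
      zero_mul, Complex.exp_zero, zero_mul, mul_one, sub_zero, h1, Complex.sinh, two_mul,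
      add_sub_cancel_right]
    field_simp
    linear_combination -2 * h2

/-- The solutions among the functions of the degenerate Krichever genera. -/
theorem toddFun_or_isDegenerate_of_solvesHirzebruchEquation {n : ℕ} (hn : 1 ≤ n) {lam q η : ℂ}
    (h : SolvesHirzebruchEquation n (degenerateKricheverFun lam q η)) :
    (∃ α β, degenerateKricheverFun lam q η = toddFun α β) ∨
      IsDegenerateEllipticOfLevel (n + 1) (degenerateKricheverFun lam q η) := by
  by_cases hη : η = 0
  · subst hη
    rw [eq_zero_of_solvesHirzebruchEquation hn h]
    exact Or.inl ⟨_, _, degenerateKricheverFun_eq_toddFun q 0⟩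
  obtain ⟨K, hK⟩ := exists_int_mul_eq hn hη h
  rcases lt_trichotomy K 0 with hneg | rfl | hpos
  · -- replacing `η` by `-η` changes the sign of `K`, but not the function
    obtain ⟨m, rfl⟩ := Int.exists_eq_neg_ofNat hneg.le
    rw [← degenerateKricheverFun_neg] at h ⊢
    refine toddFun_or_isDegenerate_of_pos hn (neg_ne_zero.2 hη) h (K := m) (by omega) ?_
    rw [hK]
    push_cast
    ring
  · have : lam = 0 := by
      have hn0 : (n : ℂ) + 1 ≠ 0 := by exact_mod_cast n.succ_ne_zero
      simpa [hn0] using hK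
    rw [this]
    exact Or.inl ⟨_, _, degenerateKricheverFun_eq_toddFun q η⟩
  · lift K to ℕ using hpos.le
    exact toddFun_or_isDegenerate_of_pos hn hη h (by exact_mod_cast hpos) (by exact_mod_cast hK)

end KricheverGenus

end

theorem mainTheorem1 (n : ℕ) (hn : 1 ≤ n) (f : ℂ → ℂ)
    (hf : KricheverGenus.IsKricheverFunction f) :
    KricheverGenus.SolvesHirzebruchEquation n f ↔
      (∃ α β : ℂ, f = KricheverGenus.toddFun α β) ∨
        ∃ d : ℕ, d ∣ n + 1 ∧
          (KricheverGenus.IsEllipticOfLevel d f ∨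
            KricheverGenus.IsDegenerateEllipticOfLevel d f) := by
  constructor
  · intro h
    rcases hf with ⟨L, α, s, hs, rfl⟩ | ⟨lam, q, η, rfl⟩
    · exact Or.inr ⟨n + 1, dvd_rfl,
        Or.inl (KricheverGenus.isEllipticOfLevel_of_solvesHirzebruchEquation hn L α hs h)⟩
    · exact (KricheverGenus.toddFun_or_isDegenerate_of_solvesHirzebruchEquation hn h).imp_right
        fun h => ⟨n + 1, dvd_rfl, Or.inr h⟩
  · rintro (⟨α, β, rfl⟩ | ⟨d, hd, h | h⟩)
    · exact KricheverGenus.solvesHirzebruchEquation_toddFun n α β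
    · exact h.solvesHirzebruchEquation hd
    · exact h.solvesHirzebruchEquation hd
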